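/- For a convex body $K\subset\mathbb{R}^3$ (a compact convex set with non-empty interior), write $\mathcal P(K)=\mathrm{Vol}(K)\,\mathrm{Vol}(K^{*})$ for its Mahler volume, where $K^{*}=\{x\in\mathbb{R}^3 : x\cdot y\le 1 \text{ for all } y\in K\}$ is the polar body. An *origin-symmetric body of revolution* is a convex body $K\subset\mathbb{R}^3$ obtained by rotating a planar region $D=\{(x,y): -a\le x\le a,\ |y|\le f(x)\}$ of the $XOY$-plane around the $X$-axis, where $a>0$ and $f:[-a,a]\to\mathbb{R}$ is concave, even and nonnegative. Such a body is called a *cylinder* if $f$ is constant on $[-a,a]$, and a *bicone* if $f$ is affine on $[-a,0]$ and $f(-a)=0$. **Theorem.** Every origin-symmetric body of revolution $K$ in $\mathbb{R}^3$ satisfies $$\mathcal P(K)\ \ge\ \frac{4\pi^2}{3},$$ with equality if and only if $K$ is a cylinder or a bicone. -/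

import Mathlib

open Set MeasureTheory

noncomputable section

namespace MahlerRevolution

/-- Euclidean three-space, with coordinates `X = 0`, `Y = 1`, `Z = 2`. -/
abbrev E3 : Type := EuclideanSpace ℝ (Fin 3)

/-- The polar body `K* = {x : x · y ≤ 1 for all y ∈ K}`. -/
def polarBody (K : Set E3) : Set E3 :=
  {x | ∀ y ∈ K, inner ℝ x y ≤ 1}

/-- The Mahler volume `Vol(K) Vol(K*)`. -/
def mahlerVolume (K : Set E3) : ℝ :=
  volume.real K * volume.real (polarBody K)

/-- The planar domain `{(x, y) : -a ≤ x ≤ a, |y| ≤ f x}`. -/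
def generatingDomain (a : ℝ) (f : ℝ → ℝ) : Set (ℝ × ℝ) :=
  {q | -a ≤ q.1 ∧ q.1 ≤ a ∧ |q.2| ≤ f q.1}

/-- The set swept out by a subset of the coordinate plane `XOY` when it is rotated around the
`X`-axis: `θ` is the angle of rotation. -/
def revolve (D : Set (ℝ × ℝ)) : Set E3 :=
  {p | ∃ q ∈ D, ∃ θ : ℝ, p = !₂[q.1, q.2 * Real.cos θ, q.2 * Real.sin θ]}

/-- The convex body `K` (compact and convex, with non-empty interior) is obtained by rotating the
generating domain of the concave, even, nonnegative function `f` on `[-a, a]` around the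
`X`-axis. The values of `f` outside `[-a, a]` play no role. -/
structure IsGeneratedBy (K : ConvexBody E3) (a : ℝ) (f : ℝ → ℝ) : Prop where
  pos : 0 < a
  concave : ConcaveOn ℝ (Icc (-a) a) f
  even : ∀ x ∈ Icc (-a) a, f (-x) = f x
  nonneg : ∀ x ∈ Icc (-a) a, 0 ≤ f x
  eq_revolve : (K : Set E3) = revolve (generatingDomain a f)
  interior_nonempty : (interior (K : Set E3)).Nonempty

/-- Origin-symmetric bodies of revolution (around the `X`-axis). -/
def IsOriginSymmetricBodyOfRevolution (K : ConvexBody E3) : Prop :=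
  ∃ (a : ℝ) (f : ℝ → ℝ), IsGeneratedBy K a f

/-- Cylinders: the generating function is constant. -/
def IsCylinder (K : ConvexBody E3) : Prop :=
  ∃ (a : ℝ) (f : ℝ → ℝ), IsGeneratedBy K a f ∧ ∃ r : ℝ, ∀ x ∈ Icc (-a) a, f x = r

/-- Bicones: the generating function is linear (of the form `m x + c`) on `[-a, 0]` and vanishes
at `-a`. -/
def IsBicone (K : ConvexBody E3) : Prop :=
  ∃ (a : ℝ) (f : ℝ → ℝ), IsGeneratedBy K a f ∧
    (∃ m c : ℝ, ∀ x ∈ Icc (-a) 0, f x = m * x + c) ∧ f (-a) = 0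

end MahlerRevolution

end

/-! Let `X` be the half-width of the body as a function of the normalised radius `y ∈ [0, 1]`: a
concave, nonincreasing function. Write `A = ∫ 2 y X(y) dy` (`radialMoment`) and let `B` be the
integral of the squared radius function of the polar profile (`polarMoment`). Then Vol(K) = 2π f(0)²
A and Vol(K*) = 2π B / f(0)², so the inequality to prove is `3 A B ≥ 1`.

The main point is that `1 / B` is subadditive in `X` (`IsProfile.harmonic_le_polarMoment_add`), a
Busemann-type fact proved by one-dimensional mass transport. Hence any bound `1 / B ≤ L` with `L`
linear passes from summands to sums. Concave nonincreasing profiles are limits of sums of constants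
and truncated ramps `c * min (1 - t) (1 - y)` (`IsProfile.exists_isGood`), so it suffices to check
the bound on these generators (`isGood_const`, `isGood_min`).

For the equality case `L` is taken smaller than `3 A`: it is `3 A` minus a third of `∫ X(y) (4 - 6
y) dy - X(0)`, a defect that is nonnegative for concave `X` and vanishes only for affine `X`. Thus
`1 / B ≤ L ≤ 3 A`, and equality forces `X` affine. For affine `X` with ratio `s = X(1) / X(0)` the
product is `1 + s (1 - s) (3 - 2 s) / 3` (`IsProfile.mul_of_affine`), which equals 1 only for `s =
1` (cylinder) and `s = 0` (bicone). -/

namespace MahlerRevolution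

noncomputable section

/-! ### Mass transport and a one-dimensional Busemann-type inequality. -/

/-- A positive density on `(0, b)` can be parametrised by its normalised mass. -/
theorem exists_mass_parametrization {b : ℝ} (hb : 0 < b) {G : ℝ → ℝ}
    (hc : ContinuousOn G (Ioo 0 b)) (hpos : ∀ u ∈ Ioo 0 b, 0 < G u)
    (hi : IntervalIntegrable G volume 0 b) :
    ∃ τ : ℝ → ℝ, ∀ θ ∈ Ioo (0 : ℝ) 1, τ θ ∈ Ioo 0 b ∧
      HasDerivAt τ ((∫ u in (0)..b, G u) / G (τ θ)) θ := by
  set B := ∫ u in (0)..b, G u with hB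
  have hBpos : 0 < B := intervalIntegral.intervalIntegral_pos_of_pos_on hi hpos hb
  set M : ℝ → ℝ := fun u => (∫ s in (0)..u, G s) / B with hM
  have hsub : ∀ {x y : ℝ}, x ∈ Icc 0 b → y ∈ Icc 0 b → IntervalIntegrable G volume x y := by
    intro x y hx hy
    refine hi.mono_set ?_
    rw [uIcc_of_le hb.le]
    exact uIcc_subset_Icc hx hy
  have hmono : StrictMonoOn M (Icc 0 b) := by
    intro x hx y hy hxy
    have h1 : 0 < ∫ s in x..y, G s := by
      refine intervalIntegral.intervalIntegral_pos_of_pos_on (hsub hx hy) ?_ hxy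
      intro z hz
      exact hpos z ⟨hx.1.trans_lt hz.1, hz.2.trans_le hy.2⟩
    have h2 := intervalIntegral.integral_add_adjacent_intervals
      (hsub (left_mem_Icc.2 hb.le) hx) (hsub hx hy)
    simp only [hM]
    gcongr
    linarith
  have hcont : ContinuousOn M (Icc 0 b) := by
    have := intervalIntegral.continuousOn_primitive_interval (μ := volume) (f := G) (a := 0) (b := b)
      (by rw [uIcc_of_le hb.le]; exact (intervalIntegrable_iff_integrableOn_Icc_of_le hb.le).1 hi)
    rw [uIcc_of_le hb.le] at this
    exact this.div_const _
  have hM0 : M 0 = 0 := by simp [hM]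
  have hMb : M b = 1 := by simp only [hM]; rw [← hB]; exact div_self hBpos.ne'
  have hsurj : ∀ θ ∈ Ioo (0 : ℝ) 1, ∃ u ∈ Ioo 0 b, M u = θ := by
    intro θ hθ
    have := intermediate_value_Ioo hb.le hcont
    rw [hM0, hMb] at this
    exact this hθ
  choose! τ hτ hMτ using hsurj
  refine ⟨τ, fun θ hθ => ⟨hτ θ hθ, ?_⟩⟩
  have hMmem : ∀ u ∈ Ioo 0 b, M u ∈ Ioo (0 : ℝ) 1 := by
    intro u hu
    refine ⟨?_, ?_⟩
    · rw [← hM0]; exact hmono (left_mem_Icc.2 hb.le) (Ioo_subset_Icc_self hu) hu.1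
    · rw [← hMb]; exact hmono (Ioo_subset_Icc_self hu) (right_mem_Icc.2 hb.le) hu.2
  have hτM : ∀ u ∈ Ioo 0 b, τ (M u) = u := by
    intro u hu
    exact hmono.injOn (Ioo_subset_Icc_self (hτ _ (hMmem u hu))) (Ioo_subset_Icc_self hu)
      (hMτ _ (hMmem u hu))
  have hτmono : StrictMonoOn τ (Ioo 0 1) := by
    intro x hx y hy hxy
    by_contra h
    have := hmono.monotoneOn (Ioo_subset_Icc_self (hτ y hy)) (Ioo_subset_Icc_self (hτ x hx))
      (not_lt.1 h)
    rw [hMτ x hx, hMτ y hy] at this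
    linarith
  have himage : τ '' Ioo 0 1 = Ioo 0 b := by
    apply Subset.antisymm
    · rintro _ ⟨x, hx, rfl⟩; exact hτ x hx
    · intro u hu; exact ⟨M u, hMmem u hu, hτM u hu⟩
  have hτc : ContinuousAt τ θ := by
    apply hτmono.continuousAt_of_image_mem_nhds (Ioo_mem_nhds hθ.1 hθ.2)
    rw [himage]
    exact Ioo_mem_nhds (hτ θ hθ).1 (hτ θ hθ).2
  have hder : HasDerivAt M (G (τ θ) / B) (τ θ) := by
    refine HasDerivAt.div_const ?_ B
    refine intervalIntegral.integral_hasDerivAt_right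
      (hsub (left_mem_Icc.2 hb.le) (Ioo_subset_Icc_self (hτ θ hθ))) ?_ ?_
    · exact hc.stronglyMeasurableAtFilter isOpen_Ioo _ (hτ θ hθ)
    · exact hc.continuousAt (Ioo_mem_nhds (hτ θ hθ).1 (hτ θ hθ).2)
  have := hder.of_local_left_inverse hτc (div_pos (hpos _ (hτ θ hθ)) hBpos).ne'
    (Filter.eventually_of_mem (Ioo_mem_nhds hθ.1 hθ.2) hMτ)
  simpa using this

/-- Two applications of Cauchy–Schwarz with `α = t / g₀`, `β = s / g₁`: first `(α + β)² ≤ (B₀ α² +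
B₁ β²) (1 / B₀ + 1 / B₁)`, then `(s + t)² ≤ (α + β) (t g₀ + s g₁)`, because `t² = α · t g₀` and `s²
= β · s g₁`. The first factor on the right is the Jacobian of the transport. -/
theorem transport_integrand_le {B₀ B₁ g₀ g₁ s t : ℝ} (hB₀ : 0 < B₀) (hB₁ : 0 < B₁)
    (hg₀ : 0 < g₀) (hg₁ : 0 < g₁) (hs : 0 < s) (ht : 0 < t) :
    B₀ * B₁ / (B₀ + B₁) ≤
      ((B₀ / g₀ ^ 2 * t ^ 2 + B₁ / g₁ ^ 2 * s ^ 2) / (s + t) ^ 2) *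
        ((t * g₀ + s * g₁) / (s + t)) ^ 2 := by
  set α := t / g₀ with hα
  set β := s / g₁ with hβ
  have hαp : 0 < α := by positivity
  have hβp : 0 < β := by positivity
  have e0 : B₀ / g₀ ^ 2 * t ^ 2 + B₁ / g₁ ^ 2 * s ^ 2 = B₀ * α ^ 2 + B₁ * β ^ 2 := by
    rw [hα, hβ]; field_simp
  have h1 : B₀ * B₁ / (B₀ + B₁) * (α + β) ^ 2 ≤ B₀ * α ^ 2 + B₁ * β ^ 2 := by
    rw [div_mul_eq_mul_div, div_le_iff₀ (by positivity)]
    nlinarith [sq_nonneg (B₀ * α - B₁ * β)]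
  have h2 : (s + t) ^ 2 ≤ (α + β) * (t * g₀ + s * g₁) := by
    have et : t = α * g₀ := by rw [hα]; field_simp
    have es : s = β * g₁ := by rw [hβ]; field_simp
    rw [et, es]
    have : 0 ≤ α * β * (g₀ - g₁) ^ 2 := by positivity
    nlinarith
  have h3 : ((s + t) ^ 2) ^ 2 ≤ ((α + β) * (t * g₀ + s * g₁)) ^ 2 := by gcongr
  rw [e0, div_pow (t * g₀ + s * g₁), div_mul_div_comm, le_div_iff₀ (by positivity)]
  have hq : 0 ≤ B₀ * B₁ / (B₀ + B₁) := by positivity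
  calc B₀ * B₁ / (B₀ + B₁) * ((s + t) ^ 2 * (s + t) ^ 2)
      = B₀ * B₁ / (B₀ + B₁) * ((s + t) ^ 2) ^ 2 := by ring
    _ ≤ B₀ * B₁ / (B₀ + B₁) * ((α + β) * (t * g₀ + s * g₁)) ^ 2 := by gcongr
    _ = B₀ * B₁ / (B₀ + B₁) * (α + β) ^ 2 * (t * g₀ + s * g₁) ^ 2 := by ring
    _ ≤ _ := by gcongr

/-- A one-dimensional inequality of Busemann type, proved by mass transport. -/
theorem harmonic_le_integral_sq {b₀ b₁ : ℝ} (hb₀ : 0 < b₀) (hb₁ : 0 < b₁) {g₀ g₁ h : ℝ → ℝ}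
    (hc₀ : ContinuousOn g₀ (Ioo 0 b₀)) (hc₁ : ContinuousOn g₁ (Ioo 0 b₁))
    (hp₀ : ∀ u ∈ Ioo 0 b₀, 0 < g₀ u) (hp₁ : ∀ u ∈ Ioo 0 b₁, 0 < g₁ u)
    (hi₀ : IntervalIntegrable (fun u => g₀ u ^ 2) volume 0 b₀)
    (hi₁ : IntervalIntegrable (fun u => g₁ u ^ 2) volume 0 b₁)
    (hi : IntervalIntegrable (fun u => h u ^ 2) volume 0 (b₀ * b₁ / (b₀ + b₁)))
    (hh : ∀ s ∈ Ioo 0 b₀, ∀ t ∈ Ioo 0 b₁,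
      (t * g₀ s + s * g₁ t) / (s + t) ≤ h (s * t / (s + t))) :
    (∫ u in (0)..b₀, g₀ u ^ 2) * (∫ u in (0)..b₁, g₁ u ^ 2) /
      ((∫ u in (0)..b₀, g₀ u ^ 2) + ∫ u in (0)..b₁, g₁ u ^ 2) ≤
      ∫ u in (0)..(b₀ * b₁ / (b₀ + b₁)), h u ^ 2 := by
  obtain ⟨τ₀, hτ₀⟩ := exists_mass_parametrization (G := fun u => g₀ u ^ 2) hb₀ (hc₀.pow 2)
    (fun u hu => pow_pos (hp₀ u hu) 2) hi₀
  obtain ⟨τ₁, hτ₁⟩ := exists_mass_parametrization (G := fun u => g₁ u ^ 2) hb₁ (hc₁.pow 2)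
    (fun u hu => pow_pos (hp₁ u hu) 2) hi₁
  have hB₀ : 0 < ∫ u in (0)..b₀, g₀ u ^ 2 :=
    intervalIntegral.intervalIntegral_pos_of_pos_on hi₀ (fun u hu => pow_pos (hp₀ u hu) 2) hb₀
  have hB₁ : 0 < ∫ u in (0)..b₁, g₁ u ^ 2 :=
    intervalIntegral.intervalIntegral_pos_of_pos_on hi₁ (fun u hu => pow_pos (hp₁ u hu) 2) hb₁
  set B₀ := ∫ u in (0)..b₀, g₀ u ^ 2
  set B₁ := ∫ u in (0)..b₁, g₁ u ^ 2
  -- Points carrying the same fraction `θ` of the two masses are matched, and their harmonic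
  -- combination is the point at which `h` is estimated. The derivative follows from `τᵢ' = Bᵢ /
  -- gᵢ(τᵢ)²`.
  set w : ℝ → ℝ := fun θ => τ₀ θ * τ₁ θ / (τ₀ θ + τ₁ θ) with hw
  set w' : ℝ → ℝ := fun θ => (B₀ / g₀ (τ₀ θ) ^ 2 * τ₁ θ ^ 2 + B₁ / g₁ (τ₁ θ) ^ 2 * τ₀ θ ^ 2) /
    (τ₀ θ + τ₁ θ) ^ 2 with hw'
  have hder : ∀ θ ∈ Ioo (0 : ℝ) 1, HasDerivAt w (w' θ) θ := by
    intro θ hθ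
    have h0 := (hτ₀ θ hθ).1.1
    have h1 := (hτ₁ θ hθ).1.1
    have := ((hτ₀ θ hθ).2.mul (hτ₁ θ hθ).2).div ((hτ₀ θ hθ).2.add (hτ₁ θ hθ).2)
      (by simpa using (add_pos h0 h1).ne')
    refine HasDerivAt.congr_deriv (f := w) this ?_
    simp only [hw']
    congr 1
    simp only [Pi.mul_apply, Pi.add_apply]
    ring
  have hw'pos : ∀ θ ∈ Ioo (0 : ℝ) 1, 0 < w' θ := by
    intro θ hθ
    have h0 := (hτ₀ θ hθ).1.1
    have h1 := (hτ₁ θ hθ).1.1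
    have h2 := hp₀ _ (hτ₀ θ hθ).1
    have h3 := hp₁ _ (hτ₁ θ hθ).1
    simp only [hw']
    positivity
  have hmono : StrictMonoOn w (Ioo 0 1) := by
    refine strictMonoOn_of_deriv_pos (convex_Ioo 0 1)
      (fun θ hθ => (hder θ hθ).continuousAt.continuousWithinAt) ?_
    intro θ hθ
    rw [interior_Ioo] at hθ
    rw [(hder θ hθ).deriv]
    exact hw'pos θ hθ
  have hb : 0 < b₀ * b₁ / (b₀ + b₁) := by positivity
  -- Inclusion is enough: the integrand `h²` is nonnegative, so enlarging the domain only helps.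
  have himage : w '' Ioo 0 1 ⊆ Ioc 0 (b₀ * b₁ / (b₀ + b₁)) := by
    rintro _ ⟨θ, hθ, rfl⟩
    have h0 := (hτ₀ θ hθ).1
    have h1 := (hτ₁ θ hθ).1
    have h0p := h0.1
    have h1p := h1.1
    refine ⟨by simp only [hw]; positivity, ?_⟩
    simp only [hw]
    rw [div_le_div_iff₀ (by positivity) (by positivity)]
    have e1 : τ₀ θ * τ₁ θ * b₀ ≤ b₀ * b₁ * τ₀ θ := by
      nlinarith [mul_pos h0p hb₀, mul_le_mul_of_nonneg_left h1.2.le (mul_pos h0p hb₀).le]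
    have e2 : τ₀ θ * τ₁ θ * b₁ ≤ b₀ * b₁ * τ₁ θ := by
      nlinarith [mul_le_mul_of_nonneg_left h0.2.le (mul_pos h1p hb₁).le]
    linarith
  have hi' : IntegrableOn (fun u => h u ^ 2) (Ioc 0 (b₀ * b₁ / (b₀ + b₁))) :=
    (intervalIntegrable_iff_integrableOn_Ioc_of_le hb.le).1 hi
  have hder' : ∀ θ ∈ Ioo (0 : ℝ) 1, HasDerivWithinAt w (w' θ) (Ioo 0 1) θ :=
    fun θ hθ => (hder θ hθ).hasDerivWithinAt
  have hint := (integrableOn_image_iff_integrableOn_abs_deriv_smul measurableSet_Ioo hder'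
    hmono.injOn (fun u => h u ^ 2)).1 (hi'.mono_set himage)
  have hchange := integral_image_eq_integral_abs_deriv_smul measurableSet_Ioo hder'
    hmono.injOn (fun u => h u ^ 2)
  rw [intervalIntegral.integral_of_le hb.le]
  calc B₀ * B₁ / (B₀ + B₁) = ∫ _θ in Ioo (0 : ℝ) 1, B₀ * B₁ / (B₀ + B₁) := by simp
    _ ≤ ∫ θ in Ioo (0 : ℝ) 1, |w' θ| • h (w θ) ^ 2 := by
        refine setIntegral_mono_on (by simp) hint measurableSet_Ioo ?_
        intro θ hθ
        have h0 := (hτ₀ θ hθ).1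
        have h1 := (hτ₁ θ hθ).1
        have h2 := hp₀ _ h0
        have h3 := hp₁ _ h1
        have h0p := h0.1
        have h1p := h1.1
        rw [abs_of_pos (hw'pos θ hθ), smul_eq_mul]
        refine (transport_integrand_le hB₀ hB₁ h2 h3 h0p h1p).trans ?_
        have := hh _ h0 _ h1
        have := hw'pos θ hθ
        simp only [hw, hw'] at *
        gcongr
    _ = ∫ u in w '' Ioo 0 1, h u ^ 2 := hchange.symm
    _ ≤ _ := setIntegral_mono_set hi' (Filter.Eventually.of_forall fun u => sq_nonneg _)
        himage.eventuallyLE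

/-! ### Polar profiles and subadditivity of the inverse polar moment. -/

/-- Half-width functions of bodies of revolution, parametrised by the normalised radius. -/
structure IsProfile (X : ℝ → ℝ) : Prop where
  antitone : AntitoneOn X (Icc 0 1)
  nonneg : ∀ y ∈ Icc (0 : ℝ) 1, 0 ≤ X y
  pos : 0 < X 0

/-- The radius function of the polar of the region `{(x, y) : |x| ≤ X |y|}`. -/
def polarProfile (X : ℝ → ℝ) (u : ℝ) : ℝ :=
  sSup {v | 0 ≤ v ∧ ∀ y ∈ Icc (0 : ℝ) 1, u * X y + v * y ≤ 1}

/-- The normalised volume of the polar body. -/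
def polarMoment (X : ℝ → ℝ) : ℝ := ∫ u in (0)..(1 / X 0), polarProfile X u ^ 2

namespace IsProfile

variable {X Y : ℝ → ℝ} {u v : ℝ}

theorem le_zero (hX : IsProfile X) {y : ℝ} (hy : y ∈ Icc (0 : ℝ) 1) : X y ≤ X 0 :=
  hX.antitone (left_mem_Icc.2 zero_le_one) hy hy.1

theorem mul_le_one (hX : IsProfile X) (hu : u ∈ Icc 0 (1 / X 0)) {y : ℝ}
    (hy : y ∈ Icc (0 : ℝ) 1) : u * X y ≤ 1 := by
  have h := (le_div_iff₀ hX.pos).1 hu.2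
  exact (mul_le_mul_of_nonneg_left (hX.le_zero hy) hu.1).trans h

theorem le_polarProfile (hX : IsProfile X) (hu : 0 ≤ u) (hv : 0 ≤ v)
    (h : ∀ y ∈ Icc (0 : ℝ) 1, u * X y + v * y ≤ 1) : v ≤ polarProfile X u := by
  refine le_csSup ⟨1, ?_⟩ ⟨hv, h⟩
  rintro w ⟨-, hw⟩
  have h1 := hw 1 (right_mem_Icc.2 zero_le_one)
  have h2 := mul_nonneg hu (hX.nonneg 1 (right_mem_Icc.2 zero_le_one))
  linarith

theorem polarProfile_spec (hX : IsProfile X) (hu : u ∈ Icc 0 (1 / X 0)) :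
    0 ≤ polarProfile X u ∧ ∀ y ∈ Icc (0 : ℝ) 1, u * X y + polarProfile X u * y ≤ 1 := by
  have h0 : ∀ y ∈ Icc (0 : ℝ) 1, u * X y + 0 * y ≤ 1 := by
    intro y hy
    simpa using hX.mul_le_one hu hy
  refine ⟨hX.le_polarProfile hu.1 le_rfl h0, fun y hy => ?_⟩
  rcases hy.1.eq_or_lt with rfl | hy0
  · simpa using hX.mul_le_one hu hy
  · have : polarProfile X u ≤ (1 - u * X y) / y := by
      refine csSup_le ⟨0, le_rfl, h0⟩ ?_
      rintro w ⟨-, hw⟩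
      rw [le_div_iff₀ hy0]
      linarith [hw y hy]
    rw [le_div_iff₀ hy0] at this
    linarith

theorem one_sub_le_polarProfile (hX : IsProfile X) (hu : u ∈ Icc 0 (1 / X 0)) :
    1 - u * X 0 ≤ polarProfile X u := by
  have h := (le_div_iff₀ hX.pos).1 hu.2
  refine hX.le_polarProfile hu.1 (by linarith) fun y hy => ?_
  have := mul_le_mul_of_nonneg_left (hX.le_zero hy) hu.1
  nlinarith [hy.1, hy.2]

theorem polarProfile_pos (hX : IsProfile X) (hu : u ∈ Ioo 0 (1 / X 0)) :
    0 < polarProfile X u := by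
  have h := (lt_div_iff₀ hX.pos).1 hu.2
  linarith [hX.one_sub_le_polarProfile (Ioo_subset_Icc_self hu)]

theorem antitoneOn_polarProfile (hX : IsProfile X) :
    AntitoneOn (polarProfile X) (Icc 0 (1 / X 0)) := by
  intro u hu w hw huw
  refine hX.le_polarProfile hu.1 (hX.polarProfile_spec hw).1 fun y hy => ?_
  have := (hX.polarProfile_spec hw).2 y hy
  nlinarith [hX.nonneg y hy]

/-- The constraints are jointly linear in `(u, v)`, so the polar region is convex whether or not `X`
is concave. This supplies the continuity that the transport argument needs. -/
theorem concaveOn_polarProfile (hX : IsProfile X) :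
    ConcaveOn ℝ (Icc 0 (1 / X 0)) (polarProfile X) := by
  refine ⟨convex_Icc _ _, fun u hu w hw p q hp hq hpq => ?_⟩
  have h1 := hX.polarProfile_spec hu
  have h2 := hX.polarProfile_spec hw
  have hm : p • u + q • w ∈ Icc 0 (1 / X 0) := convex_Icc _ _ hu hw hp hq hpq
  simp only [smul_eq_mul] at hm ⊢
  refine hX.le_polarProfile hm.1
    (add_nonneg (mul_nonneg hp h1.1) (mul_nonneg hq h2.1)) fun y hy => ?_
  nlinarith [mul_le_mul_of_nonneg_left (h1.2 y hy) hp, mul_le_mul_of_nonneg_left (h2.2 y hy) hq]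

theorem continuousOn_polarProfile (hX : IsProfile X) :
    ContinuousOn (polarProfile X) (Ioo 0 (1 / X 0)) := by
  have := hX.concaveOn_polarProfile.continuousOn_interior
  rwa [interior_Icc] at this

theorem antitoneOn_polarProfile_sq (hX : IsProfile X) :
    AntitoneOn (fun u => polarProfile X u ^ 2) (Icc 0 (1 / X 0)) := by
  intro u hu w hw huw
  have := (hX.polarProfile_spec hw).1
  have := hX.antitoneOn_polarProfile hu hw huw
  dsimp only
  gcongr

theorem intervalIntegrable_polarProfile_sq (hX : IsProfile X) {c d : ℝ}
    (hc : c ∈ Icc 0 (1 / X 0)) (hd : d ∈ Icc 0 (1 / X 0)) :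
    IntervalIntegrable (fun u => polarProfile X u ^ 2) volume c d :=
  AntitoneOn.intervalIntegrable (hX.antitoneOn_polarProfile_sq.mono (uIcc_subset_Icc hc hd))

theorem zero_mem (hX : IsProfile X) : (0 : ℝ) ∈ Icc 0 (1 / X 0) :=
  left_mem_Icc.2 (one_div_pos.2 hX.pos).le

theorem end_mem (hX : IsProfile X) : 1 / X 0 ∈ Icc 0 (1 / X 0) :=
  right_mem_Icc.2 (one_div_pos.2 hX.pos).le

theorem polarMoment_pos (hX : IsProfile X) : 0 < polarMoment X :=
  intervalIntegral.intervalIntegral_pos_of_pos_on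
    (hX.intervalIntegrable_polarProfile_sq hX.zero_mem hX.end_mem)
    (fun _ hu => pow_pos (hX.polarProfile_pos hu) 2) (one_div_pos.2 hX.pos)

theorem add (hX : IsProfile X) (hY : IsProfile Y) : IsProfile (fun y => X y + Y y) where
  antitone := hX.antitone.add hY.antitone
  nonneg y hy := add_nonneg (hX.nonneg y hy) (hY.nonneg y hy)
  pos := add_pos hX.pos hY.pos

/-- The inverse of the polar moment is subadditive. -/
theorem harmonic_le_polarMoment_add (hX : IsProfile X) (hY : IsProfile Y) :
    polarMoment X * polarMoment Y / (polarMoment X + polarMoment Y) ≤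
      polarMoment (fun y => X y + Y y) := by
  have hX0 := hX.pos
  have hY0 := hY.pos
  have e : 1 / X 0 * (1 / Y 0) / (1 / X 0 + 1 / Y 0) = 1 / (X 0 + Y 0) := by
    field_simp
    ring
  have hXY := hX.add hY
  have := harmonic_le_integral_sq (one_div_pos.2 hX.pos) (one_div_pos.2 hY.pos)
    (h := polarProfile fun y => X y + Y y)
    hX.continuousOn_polarProfile hY.continuousOn_polarProfile
    (fun u hu => hX.polarProfile_pos hu) (fun u hu => hY.polarProfile_pos hu)
    (hX.intervalIntegrable_polarProfile_sq hX.zero_mem hX.end_mem)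
    (hY.intervalIntegrable_polarProfile_sq hY.zero_mem hY.end_mem)
    (by rw [e]; exact hXY.intervalIntegrable_polarProfile_sq hXY.zero_mem hXY.end_mem) ?_
  · rwa [e] at this
  -- Weighting the constraint for `X` at `s` by `t / (s + t)` and the one for `Y` at `t` by `s / (s
  -- + t)` gives both profiles the common coefficient `s t / (s + t)`.
  · intro s hs t ht
    have hs0 := hs.1
    have ht0 := ht.1
    have h1 := hX.polarProfile_spec (Ioo_subset_Icc_self hs)
    have h2 := hY.polarProfile_spec (Ioo_subset_Icc_self ht)
    refine hXY.le_polarProfile (by positivity)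
      (div_nonneg (add_nonneg (mul_nonneg ht0.le h1.1) (mul_nonneg hs0.le h2.1)) (by positivity))
      fun y hy => ?_
    have h3 := mul_le_mul_of_nonneg_left (h1.2 y hy) ht0.le
    have h4 := mul_le_mul_of_nonneg_left (h2.2 y hy) hs0.le
    rw [div_mul_eq_mul_div, div_mul_eq_mul_div, ← add_div, div_le_one (by positivity)]
    linarith

/-- Polarity reverses inclusion. This is why profiles are later approximated from above. -/
theorem polarMoment_le (hX : IsProfile X) (hY : IsProfile Y)
    (h : ∀ y ∈ Icc (0 : ℝ) 1, X y ≤ Y y) : polarMoment Y ≤ polarMoment X := by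
  have h0 := h 0 (left_mem_Icc.2 zero_le_one)
  have hle : 1 / Y 0 ≤ 1 / X 0 := one_div_le_one_div_of_le hX.pos h0
  have hmem : 1 / Y 0 ∈ Icc 0 (1 / X 0) := ⟨(one_div_pos.2 hY.pos).le, hle⟩
  have hsub : Icc 0 (1 / Y 0) ⊆ Icc 0 (1 / X 0) := Icc_subset_Icc_right hle
  have h1 : polarMoment Y ≤ ∫ u in (0)..(1 / Y 0), polarProfile X u ^ 2 := by
    refine intervalIntegral.integral_mono_on hmem.1
      (hY.intervalIntegrable_polarProfile_sq hY.zero_mem hY.end_mem)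
      (hX.intervalIntegrable_polarProfile_sq hX.zero_mem hmem) fun u hu => ?_
    have h2 := hY.polarProfile_spec hu
    refine pow_le_pow_left₀ h2.1 (hX.le_polarProfile hu.1 h2.1 fun y hy => ?_) 2
    nlinarith [h2.2 y hy, mul_le_mul_of_nonneg_left (h y hy) hu.1]
  have h2 := intervalIntegral.integral_add_adjacent_intervals
    (hX.intervalIntegrable_polarProfile_sq hX.zero_mem hmem)
    (hX.intervalIntegrable_polarProfile_sq hmem hX.end_mem)
  have h3 : 0 ≤ ∫ u in (1 / Y 0)..(1 / X 0), polarProfile X u ^ 2 :=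
    intervalIntegral.integral_nonneg hle fun u _ => sq_nonneg _
  have h4 : polarMoment X = ∫ u in (0)..(1 / X 0), polarProfile X u ^ 2 := rfl
  linarith

theorem intervalIntegrable (hX : IsProfile X) : IntervalIntegrable X volume 0 1 :=
  AntitoneOn.intervalIntegrable (by rw [uIcc_of_le zero_le_one]; exact hX.antitone)

theorem intervalIntegrable_mul (hX : IsProfile X) {k : ℝ → ℝ} (hk : Continuous k) :
    IntervalIntegrable (fun y => X y * k y) volume 0 1 :=
  hX.intervalIntegrable.mul_continuousOn hk.continuousOn

end IsProfile

/-! ### The linear bound: generators, sums and approximation. -/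

/-- A linear functional that dominates the inverse of the polar moment. -/
def linearBound (X : ℝ → ℝ) : ℝ := (∫ y in (0 : ℝ)..1, X y * (8 * y - 4 / 3)) + X 0 / 3

/-- Profiles for which the linear bound is known; the class is closed under addition. -/
structure IsGood (X : ℝ → ℝ) : Prop extends IsProfile X where
  one_le : 1 ≤ polarMoment X * linearBound X

/-- The harmonic inequality says `1 / B` is subadditive, while `linearBound` is additive; so `1 / B
≤ L` survives addition. -/
theorem IsGood.add {X Y : ℝ → ℝ} (hX : IsGood X) (hY : IsGood Y) :
    IsGood (fun y => X y + Y y) := by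
  refine ⟨hX.toIsProfile.add hY.toIsProfile, ?_⟩
  have h0 := hX.toIsProfile.polarMoment_pos
  have h1 := hY.toIsProfile.polarMoment_pos
  have h2 := hX.toIsProfile.harmonic_le_polarMoment_add hY.toIsProfile
  have hl : linearBound (fun y => X y + Y y) = linearBound X + linearBound Y := by
    simp only [linearBound, add_mul]
    rw [intervalIntegral.integral_add
      (hX.toIsProfile.intervalIntegrable_mul (by fun_prop))
      (hY.toIsProfile.intervalIntegrable_mul (by fun_prop))]
    ring
  have h3 : 1 / polarMoment X ≤ linearBound X := by
    rw [div_le_iff₀ h0]; linarith [hX.one_le]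
  have h4 : 1 / polarMoment Y ≤ linearBound Y := by
    rw [div_le_iff₀ h1]; linarith [hY.one_le]
  rw [hl]
  calc (1 : ℝ) = polarMoment X * polarMoment Y / (polarMoment X + polarMoment Y) *
        (1 / polarMoment X + 1 / polarMoment Y) := by
        field_simp
        ring
    _ ≤ _ := by gcongr; exact (hX.toIsProfile.add hY.toIsProfile).polarMoment_pos.le

theorem isGood_const {c : ℝ} (hc : 0 < c) : IsGood (fun _ => c) := by
  have hp : IsProfile (fun _ => c) := ⟨fun _ _ _ _ _ => le_rfl, fun _ _ => hc.le, hc⟩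
  refine ⟨hp, ?_⟩
  have hl : linearBound (fun _ => c) = 3 * c := by
    simp only [linearBound]
    rw [intervalIntegral.integral_const_mul, intervalIntegral.integral_sub
      (by apply Continuous.intervalIntegrable; fun_prop)
      (by apply Continuous.intervalIntegrable; fun_prop),
      intervalIntegral.integral_const_mul, integral_id]
    norm_num
    ring
  have hB : 1 / (3 * c) ≤ polarMoment (fun _ => c) := by
    have h1 : ∫ u in (0)..(1 / c), (1 - u * c) ^ 2 = 1 / (3 * c) := by
      have : ∀ u, HasDerivAt (fun u => -(1 - u * c) ^ 3 / (3 * c)) ((1 - u * c) ^ 2) u := by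
        intro u
        have := ((((hasDerivAt_id u).mul_const c).const_sub 1).pow 3).neg.div_const (3 * c)
        refine HasDerivAt.congr_deriv this ?_
        simp
        field_simp
      rw [intervalIntegral.integral_eq_sub_of_hasDerivAt (fun u _ => this u)
        (by apply Continuous.intervalIntegrable; fun_prop)]
      field_simp
      ring
    rw [← h1]
    refine intervalIntegral.integral_mono_on (one_div_pos.2 hc).le
      (by apply Continuous.intervalIntegrable; fun_prop)
      (hp.intervalIntegrable_polarProfile_sq hp.zero_mem hp.end_mem) fun u hu => ?_
    have h2 := (le_div_iff₀ hc).1 hu.2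
    exact pow_le_pow_left₀ (by linarith) (hp.one_sub_le_polarProfile hu) 2
  rw [hl]
  have := mul_le_mul_of_nonneg_right hB (by positivity : 0 ≤ 3 * c)
  rwa [one_div_mul_cancel (by positivity)] at this

/-- With `b = 1 / X 0`, the polar profile is bounded below by 1 on `[0, (1 - t) b]` and by the line
`(1 - u / b) / t`, descending to 0, on the rest. The resulting lower bound for the product is
exactly `1 + 8/9 t² (1 - t)`. -/
theorem isGood_min {c t : ℝ} (hc : 0 < c) (ht : t ∈ Ico (0 : ℝ) 1) :
    IsGood (fun y => c * min (1 - t) (1 - y)) := by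
  have ht0 := ht.1
  have ht1 : 0 < 1 - t := sub_pos.2 ht.2
  set X : ℝ → ℝ := fun y => c * min (1 - t) (1 - y) with hXdef
  have hX0 : X 0 = c * (1 - t) := by simp [hXdef, ht0]
  have hp : IsProfile X := by
    refine ⟨fun x _ y _ hxy => ?_, fun y hy => ?_, ?_⟩
    · simp only [hXdef]; gcongr
    · have : 0 ≤ min (1 - t) (1 - y) := le_min ht1.le (by linarith [hy.2])
      simp only [hXdef]; positivity
    · rw [hX0]; positivity
  refine ⟨hp, ?_⟩
  have hl : linearBound X = c * ((1 - t) * (1 + t + t ^ 2) - t * (1 - t) ^ 2 / 3) := by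
    have hi : ∀ a b : ℝ, IntervalIntegrable (fun y => X y * (8 * y - 4 / 3)) volume a b := by
      intro a b
      apply Continuous.intervalIntegrable
      fun_prop
    have e1 : ∫ y in (0 : ℝ)..t, X y * (8 * y - 4 / 3) =
        c * (1 - t) * (4 * t ^ 2 - 4 / 3 * t) := by
      have : ∫ y in (0 : ℝ)..t, X y * (8 * y - 4 / 3) =
          ∫ y in (0 : ℝ)..t, c * (1 - t) * (8 * y - 4 / 3) := by
        refine intervalIntegral.integral_congr fun y hy => ?_
        rw [uIcc_of_le ht0] at hy
        simp only [hXdef]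
        rw [min_eq_left (by linarith [hy.2])]
      rw [this]
      have hd : ∀ u, HasDerivAt (fun u => c * (1 - t) * (4 * u ^ 2 - 4 / 3 * u))
          (c * (1 - t) * (8 * u - 4 / 3)) u := by
        intro u
        have := ((((hasDerivAt_id u).pow 2).const_mul 4).sub
          ((hasDerivAt_id u).const_mul (4 / 3))).const_mul (c * (1 - t))
        refine HasDerivAt.congr_deriv this ?_
        simp only [id]
        push_cast
        ring
      rw [intervalIntegral.integral_eq_sub_of_hasDerivAt (fun u _ => hd u)
        (by apply Continuous.intervalIntegrable; fun_prop)]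
      ring
    have e2 : ∫ y in t..1, X y * (8 * y - 4 / 3) =
        c * ((-8 / 3 + 14 / 3 - 4 / 3) - (-8 / 3 * t ^ 3 + 14 / 3 * t ^ 2 - 4 / 3 * t)) := by
      have : ∫ y in t..1, X y * (8 * y - 4 / 3) =
          ∫ y in t..1, c * (1 - y) * (8 * y - 4 / 3) := by
        refine intervalIntegral.integral_congr fun y hy => ?_
        rw [uIcc_of_le ht.2.le] at hy
        simp only [hXdef]
        rw [min_eq_right (by linarith [hy.1])]
      rw [this]
      have hd : ∀ u, HasDerivAt (fun u => c * (-8 / 3 * u ^ 3 + 14 / 3 * u ^ 2 - 4 / 3 * u))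
          (c * (1 - u) * (8 * u - 4 / 3)) u := by
        intro u
        have := (((((hasDerivAt_id u).pow 3).const_mul (-8 / 3)).add
          (((hasDerivAt_id u).pow 2).const_mul (14 / 3))).sub
          ((hasDerivAt_id u).const_mul (4 / 3))).const_mul c
        refine HasDerivAt.congr_deriv this ?_
        simp
        ring
      rw [intervalIntegral.integral_eq_sub_of_hasDerivAt (fun u _ => hd u)
        (by apply Continuous.intervalIntegrable; fun_prop)]
      ring
    rw [linearBound, ← intervalIntegral.integral_add_adjacent_intervals (hi 0 t) (hi t 1),
      e1, e2, hX0]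
    ring
  have hB : (1 - 2 * t / 3) / (c * (1 - t)) ≤ polarMoment X := by
    set b := 1 / X 0 with hb
    have hbpos : 0 < b := one_div_pos.2 hp.pos
    have hm : (1 - t) * b ∈ Icc 0 b := ⟨by positivity, by nlinarith⟩
    have hcb : c * (1 - t) * b = 1 := by rw [hb, hX0]; field_simp
    have h1 : (1 - t) * b ≤ ∫ u in (0)..((1 - t) * b), polarProfile X u ^ 2 := by
      have : ∫ u in (0)..((1 - t) * b), (1 : ℝ) = (1 - t) * b := by simp
      refine this.symm.le.trans ?_
      refine intervalIntegral.integral_mono_on hm.1 (by simp)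
        (hp.intervalIntegrable_polarProfile_sq hp.zero_mem hm) fun u hu => ?_
      have : 1 ≤ polarProfile X u := by
        refine hp.le_polarProfile hu.1 zero_le_one fun y hy => ?_
        have h3 : u * X y ≤ ((1 - t) * b) * (c * (1 - y)) := by
          apply mul_le_mul hu.2 _ (hp.nonneg y hy) hm.1
          simp only [hXdef]
          gcongr
          exact min_le_right _ _
        have h4 : ((1 - t) * b) * (c * (1 - y)) = 1 - y := by linear_combination (1 - y) * hcb
        linarith
      nlinarith
    have h2 : t * b / 3 ≤ ∫ u in ((1 - t) * b)..b, polarProfile X u ^ 2 := by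
      -- For `t = 0` the tail interval is degenerate, and the slope `1 / t` must not be used.
      rcases ht0.eq_or_lt with rfl | htpos
      · simp
      have : ∫ u in ((1 - t) * b)..b, ((1 - u / b) / t) ^ 2 = t * b / 3 := by
        have hd : ∀ u, HasDerivAt (fun u => -b / (3 * t ^ 2) * (1 - u / b) ^ 3)
            (((1 - u / b) / t) ^ 2) u := by
          intro u
          have := ((((hasDerivAt_id u).div_const b).const_sub 1).pow 3).const_mul
            (-b / (3 * t ^ 2))
          refine HasDerivAt.congr_deriv this ?_
          simp
          field_simp
        rw [intervalIntegral.integral_eq_sub_of_hasDerivAt (fun u _ => hd u)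
          (by apply Continuous.intervalIntegrable; fun_prop)]
        field_simp
        ring
      rw [← this]
      refine intervalIntegral.integral_mono_on hm.2
        (by apply Continuous.intervalIntegrable; fun_prop)
        (hp.intervalIntegrable_polarProfile_sq hm hp.end_mem) fun u hu => ?_
      have hu1 : u / b ≤ 1 := (div_le_one hbpos).2 hu.2
      have hu2 : 1 - t ≤ u / b := (le_div_iff₀ hbpos).2 hu.1
      have hv : 0 ≤ (1 - u / b) / t := div_nonneg (by linarith) ht0
      refine pow_le_pow_left₀ hv (hp.le_polarProfile (hm.1.trans hu.1) hv fun y hy => ?_) 2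
      have hub : u = u / b * b := by field_simp
      obtain ⟨p, hpe⟩ : ∃ p, u / b = p := ⟨_, rfl⟩
      rw [hpe] at hu1 hu2 hv hub ⊢
      have hXe : u * X y * (1 - t) = p * min (1 - t) (1 - y) := by
        rw [hub]
        simp only [hXdef]
        linear_combination p * min (1 - t) (1 - y) * hcb
      have hmin : p * min (1 - t) (1 - y) + (1 - p) / t * y * (1 - t) ≤ 1 - t := by
        rw [div_mul_eq_mul_div, div_mul_eq_mul_div]
        have : (1 - p) * y * (1 - t) / t ≤ 1 - t - p * min (1 - t) (1 - y) := by
          rw [div_le_iff₀ htpos]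
          rcases le_total y t with h | h
          · rw [min_eq_left (by linarith)]
            nlinarith [mul_nonneg (mul_nonneg (sub_nonneg.2 hu1) ht1.le) (sub_nonneg.2 h)]
          · rw [min_eq_right (by linarith)]
            nlinarith [mul_nonneg (sub_nonneg.2 hu2) (sub_nonneg.2 h)]
        linarith
      have : (u * X y + (1 - p) / t * y) * (1 - t) ≤ 1 * (1 - t) := by linarith
      exact le_of_mul_le_mul_right this ht1
    have h3 := intervalIntegral.integral_add_adjacent_intervals
      (hp.intervalIntegrable_polarProfile_sq hp.zero_mem hm)
      (hp.intervalIntegrable_polarProfile_sq hm hp.end_mem)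
    have h4 : (1 - 2 * t / 3) / (c * (1 - t)) = (1 - t) * b + t * b / 3 := by
      rw [hb, hX0]
      field_simp
      ring
    rw [h4, polarMoment, ← h3]
    exact add_le_add h1 h2
  rw [hl]
  have hq : 0 ≤ c * ((1 - t) * (1 + t + t ^ 2) - t * (1 - t) ^ 2 / 3) := by
    have : (1 - t) * (1 + t + t ^ 2) - t * (1 - t) ^ 2 / 3 =
        (1 - t) * (1 + 2 * t / 3 + 4 * t ^ 2 / 3) := by ring
    rw [this]
    positivity
  refine le_trans ?_ (mul_le_mul_of_nonneg_right hB hq)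
  have e : (1 - 2 * t / 3) / (c * (1 - t)) *
      (c * ((1 - t) * (1 + t + t ^ 2) - t * (1 - t) ^ 2 / 3)) =
      1 + 8 / 9 * t ^ 2 * (1 - t) := by
    field_simp
    ring
  rw [e]
  have : 0 ≤ 8 / 9 * t ^ 2 * (1 - t) := by positivity
  linarith

theorem IsGood.add_min {X : ℝ → ℝ} (hX : IsGood X) {c t : ℝ} (hc : 0 ≤ c)
    (ht : t ∈ Ico (0 : ℝ) 1) : IsGood (fun y => X y + c * min (1 - t) (1 - y)) := by
  rcases hc.eq_or_lt with rfl | hc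
  · simpa using hX
  · exact hX.add (isGood_min hc ht)

theorem IsGood.add_sum_min {X : ℝ → ℝ} (hX : IsGood X) (c t : ℕ → ℝ) (n : ℕ)
    (hc : ∀ k < n, 0 ≤ c k) (ht : ∀ k < n, t k ∈ Ico (0 : ℝ) 1) :
    IsGood (fun y => X y + ∑ k ∈ Finset.range n, c k * min (1 - t k) (1 - y)) := by
  induction n with
  | zero => simpa using hX
  | succ n ih =>
    have := (ih (fun k hk => hc k (hk.trans n.lt_succ_self))
      (fun k hk => ht k (hk.trans n.lt_succ_self))).add_min (hc n n.lt_succ_self)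
      (ht n n.lt_succ_self)
    simpa only [Finset.sum_range_succ, add_assoc] using this

/-- Summation by parts: it turns a sum of ramps weighted by second differences into a sum of slopes
times increments. -/
theorem sum_sub_mul_eq (d w : ℕ → ℝ) (hd : d 0 = 0) (n : ℕ) :
    ∑ k ∈ Finset.range n, (d (k + 1) - d k) * w k =
      ∑ k ∈ Finset.range n, d (k + 1) * (w k - w (k + 1)) + d n * w n := by
  induction n with
  | zero => simp [hd]
  | succ n ih => rw [Finset.sum_range_succ, ih, Finset.sum_range_succ]; ring

/-- A concave nonincreasing function is approximated from above by sums of truncated ramps. -/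
theorem IsProfile.exists_isGood {X : ℝ → ℝ} (hX : IsProfile X) (hconc : ConcaveOn ℝ (Icc 0 1) X)
    (hcont : ContinuousOn X (Icc 0 1)) {ε : ℝ} (hε : 0 < ε) :
    ∃ Y, IsGood Y ∧ ∀ y ∈ Icc (0 : ℝ) 1, X y ≤ Y y ∧ Y y ≤ X y + 2 * ε := by
  obtain ⟨δ, hδ, hunif⟩ := Metric.uniformContinuousOn_iff.1
    (isCompact_Icc.uniformContinuousOn_of_continuous hcont) ε hε
  obtain ⟨m, hm⟩ := exists_nat_one_div_lt hδ
  set n : ℕ := m + 1 with hn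
  have hn0 : (0 : ℝ) < n := by rw [hn]; positivity
  set t : ℕ → ℝ := fun k => k / n with ht
  have htstep : ∀ k, t (k + 1) = t k + 1 / n := by
    intro k; simp only [ht]; push_cast; ring
  have htmono : ∀ k, t k ≤ t (k + 1) := by
    intro k; rw [htstep]; linarith [one_div_pos.2 hn0]
  have ht0 : t 0 = 0 := by simp [ht]
  have htn : t n = 1 := by simp only [ht]; exact div_self hn0.ne'
  have htmem : ∀ k ≤ n, t k ∈ Icc (0 : ℝ) 1 := by
    intro k hk
    refine ⟨by positivity, (div_le_one hn0).2 (by exact_mod_cast hk)⟩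
  have htmem' : ∀ k < n, t k ∈ Ico (0 : ℝ) 1 := by
    intro k hk
    refine ⟨by positivity, (div_lt_one hn0).2 (by exact_mod_cast hk)⟩
  have hosc : ∀ k < n, X (t k) - X (t (k + 1)) ≤ ε := by
    intro k hk
    have := hunif (t k) (htmem k hk.le) (t (k + 1)) (htmem (k + 1) hk) (by
      rw [htstep, Real.dist_eq, abs_sub_comm, add_sub_cancel_left, abs_of_pos (one_div_pos.2 hn0)]
      rw [hn]; push_cast; exact hm)
    rw [Real.dist_eq] at this
    exact (le_abs_self _).trans this.le
  -- `d (k + 1)` is minus the slope of the piecewise linear interpolant on `[t k, t (k + 1)]`. The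
  -- convention `d 0 = 0` counts the initial slope as a kink at 0; its sign comes from monotonicity,
  -- that of the later kinks from concavity.
  set d : ℕ → ℝ := fun k => if k = 0 then 0 else n * (X (t (k - 1)) - X (t k)) with hd
  have hdS : ∀ k, d (k + 1) = n * (X (t k) - X (t (k + 1))) := by intro k; simp [hd]
  have hdmono : ∀ k < n, 0 ≤ d (k + 1) - d k := by
    intro k hk
    rcases k with _ | k
    · rw [hdS]
      have := hX.antitone (htmem 0 (Nat.zero_le _)) (htmem 1 hk) (htmono 0)
      simp only [hd, if_true, sub_zero]
      exact mul_nonneg hn0.le (sub_nonneg.2 this)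
    · rw [hdS, hdS, ← mul_sub]
      refine mul_nonneg hn0.le ?_
      have := hconc.2 (htmem k (by omega)) (htmem (k + 2) hk)
        (by norm_num : (0 : ℝ) ≤ 1 / 2) (by norm_num : (0 : ℝ) ≤ 1 / 2) (by norm_num)
      have e : (1 / 2 : ℝ) • t k + (1 / 2 : ℝ) • t (k + 2) = t (k + 1) := by
        rw [htstep (k + 1), htstep k]; simp only [smul_eq_mul]; ring
      rw [e] at this
      simp only [smul_eq_mul] at this
      linarith
  -- The shift by `ε` lifts the interpolant above `X`, and it keeps the constant summand positive
  -- even if `X 1 = 0`.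
  refine ⟨fun y => (X 1 + ε) + ∑ k ∈ Finset.range n, (d (k + 1) - d k) * min (1 - t k) (1 - y),
    (isGood_const (by linarith [hX.nonneg 1 (right_mem_Icc.2 zero_le_one)])).add_sum_min
      (fun k => d (k + 1) - d k) t n hdmono htmem', fun y hy => ?_⟩
  have habel := sum_sub_mul_eq d (fun k => min (1 - t k) (1 - y)) (by simp [hd]) n
  rw [htn, sub_self, min_eq_left (by linarith [hy.2] : (0 : ℝ) ≤ 1 - y), mul_zero, add_zero]
    at habel
  beta_reduce
  rw [habel]
  set S : ℕ → ℝ := fun N => ∑ k ∈ Finset.range N,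
    d (k + 1) * (min (1 - t k) (1 - y) - min (1 - t (k + 1)) (1 - y)) with hS
  -- A cell lying below `y` contributes nothing, a cell above `y` contributes its full drop of `X`,
  -- and the cell containing `y` contributes a fraction of its drop, which is at most `ε`.
  have key : ∀ N ≤ n, (t N ≤ y → S N = 0) ∧
      (y ≤ t N → X y - X (t N) - ε ≤ S N ∧ S N ≤ X y - X (t N) + ε) := by
    intro N
    induction N with
    | zero =>
      intro _
      refine ⟨fun _ => by simp [hS], fun h => ?_⟩
      have : y = t 0 := le_antisymm h (by rw [ht0]; exact hy.1)
      rw [this]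
      simp [hS, hε.le]
    | succ N ih =>
      intro hN
      obtain ⟨ih0, ih1⟩ := ih (by omega)
      have hNn : N < n := hN
      have hstep : S (N + 1) = S N + (X (t N) - X (t (N + 1))) *
          (n * (min (1 - t N) (1 - y) - min (1 - t (N + 1)) (1 - y))) := by
        simp only [hS, Finset.sum_range_succ, hdS]; ring
      have hxx := hX.antitone (htmem N hNn.le) (htmem (N + 1) hN) (htmono N)
      have hmN := htmono N
      have hst := htstep N
      constructor
      · intro h
        rw [hstep, ih0 (hmN.trans h), min_eq_right (by linarith), min_eq_right (by linarith)]
        ring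
      · intro h
        rcases le_total y (t N) with hyN | hyN
        · obtain ⟨h1, h2⟩ := ih1 hyN
          have : S (N + 1) = S N + (X (t N) - X (t (N + 1))) := by
            rw [hstep, min_eq_left (by linarith), min_eq_left (by linarith), hst]
            field_simp
            ring
          rw [this]
          constructor <;> linarith
        · rw [hstep, ih0 hyN, min_eq_right (by linarith), min_eq_left (by linarith)]
          have hl0 : 0 ≤ n * (1 - y - (1 - t (N + 1))) := mul_nonneg hn0.le (by linarith)
          have hl1 : n * (1 - y - (1 - t (N + 1))) ≤ 1 := by
            have : 1 - y - (1 - t (N + 1)) ≤ 1 / n := by linarith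
            calc _ ≤ (n : ℝ) * (1 / n) := by gcongr
              _ = 1 := by field_simp
          have h1 := hosc N hNn
          have h2 := hX.antitone (htmem N hNn.le) hy hyN
          have h3 := hX.antitone hy (htmem (N + 1) hN) h
          have h4 := mul_nonneg (sub_nonneg.2 hxx) hl0
          have h5 := mul_le_mul_of_nonneg_left hl1 (sub_nonneg.2 hxx)
          constructor <;> linarith
  obtain ⟨h1, h2⟩ := (key n le_rfl).2 (by rw [htn]; exact hy.2)
  rw [htn] at h1 h2
  simp only [hS] at h1 h2
  constructor <;> linarith

theorem IsProfile.one_le_polarMoment_mul_linearBound {X : ℝ → ℝ} (hX : IsProfile X)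
    (hconc : ConcaveOn ℝ (Icc 0 1) X) (hcont : ContinuousOn X (Icc 0 1)) :
    1 ≤ polarMoment X * linearBound X := by
  refine le_of_forall_pos_le_add fun η hη => ?_
  have hB := hX.polarMoment_pos
  -- The approximation error `2 ε` costs at most `16 ε` in the integral, whose weight is at most 8,
  -- and `2 ε / 3` in the term `X 0 / 3`; 18 covers both.
  set ε := η / (18 * polarMoment X) with hε
  have hεpos : 0 < ε := by positivity
  obtain ⟨Y, hY, hXY⟩ := hX.exists_isGood hconc hcont hεpos
  have hBY := hX.polarMoment_le hY.toIsProfile fun y hy => (hXY y hy).1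
  have hL : linearBound Y ≤ linearBound X + 18 * ε := by
    have h0 := (hXY 0 (left_mem_Icc.2 zero_le_one)).2
    have hk : Continuous fun y : ℝ => 8 * y - 4 / 3 := by fun_prop
    have h1 : (∫ y in (0 : ℝ)..1, Y y * (8 * y - 4 / 3)) ≤
        ∫ y in (0 : ℝ)..1, (X y * (8 * y - 4 / 3) + 16 * ε) := by
      refine intervalIntegral.integral_mono_on zero_le_one
        (hY.toIsProfile.intervalIntegrable_mul hk)
        ((hX.intervalIntegrable_mul hk).add (by simp)) fun y hy => ?_
      obtain ⟨h2, h3⟩ := hXY y hy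
      have h4 : (Y y - X y) * (8 * y - 4 / 3) ≤ (Y y - X y) * 8 :=
        mul_le_mul_of_nonneg_left (by linarith [hy.2]) (by linarith)
      linarith
    rw [intervalIntegral.integral_add (hX.intervalIntegrable_mul hk) (by simp)] at h1
    simp only [intervalIntegral.integral_const, sub_zero, one_smul] at h1
    simp only [linearBound]
    linarith
  have hBY0 := hY.toIsProfile.polarMoment_pos
  have hLY : 0 ≤ linearBound Y := by
    by_contra h
    nlinarith [hY.one_le, mul_pos hBY0 (neg_pos.2 (not_le.1 h))]
  calc (1 : ℝ) ≤ polarMoment Y * linearBound Y := hY.one_le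
    _ ≤ polarMoment X * linearBound Y := by gcongr
    _ ≤ polarMoment X * (linearBound X + 18 * ε) := by gcongr
    _ = polarMoment X * linearBound X + η := by rw [hε]; field_simp

/-! ### Comparison of the linear bound with the radial moment, and the affine case. -/

/-- The normalised volume of a body of revolution in terms of its half-width function. -/
def radialMoment (X : ℝ → ℝ) : ℝ := ∫ y in (0 : ℝ)..1, 2 * y * X y

/-- The weights satisfy `8 y - 4/3 = 6 y - (4 - 6 y) / 3`. -/
theorem IsProfile.linearBound_eq {X : ℝ → ℝ} (hX : IsProfile X) :
    linearBound X =
      3 * radialMoment X - ((∫ y in (0 : ℝ)..1, X y * (4 - 6 * y)) - X 0) / 3 := by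
  have h1 : radialMoment X = ∫ y in (0 : ℝ)..1, X y * (2 * y) := by
    simp only [radialMoment]
    congr 1
    ext y
    ring
  have h2 : (∫ y in (0 : ℝ)..1, X y * (8 * y - 4 / 3)) =
      ∫ y in (0 : ℝ)..1, (3 * (X y * (2 * y)) - 1 / 3 * (X y * (4 - 6 * y))) := by
    congr 1
    ext y
    ring
  rw [linearBound, h1, h2, intervalIntegral.integral_sub
    ((hX.intervalIntegrable_mul (by fun_prop)).const_mul _)
    ((hX.intervalIntegrable_mul (by fun_prop)).const_mul _),
    intervalIntegral.integral_const_mul, intervalIntegral.integral_const_mul]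
  ring

/-- The secant of `X` through `0` and `2 / 3`. -/
def secant (X : ℝ → ℝ) (y : ℝ) : ℝ := X 0 + (X (2 / 3) - X 0) * (3 / 2) * y

/-- The weight `4 - 6 y` has integral 1 and first moment 0 on `[0, 1]`, so it evaluates affine
functions at 0. -/
theorem integral_secant_mul (X : ℝ → ℝ) :
    ∫ y in (0 : ℝ)..1, secant X y * (4 - 6 * y) = X 0 := by
  obtain ⟨c, hc⟩ : ∃ c, (X (2 / 3) - X 0) * (3 / 2) = c := ⟨_, rfl⟩
  simp only [secant, hc]
  have hd : ∀ u, HasDerivAt (fun u => X 0 * (4 * u - 3 * u ^ 2) + c * (2 * u ^ 2 - 2 * u ^ 3))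
      ((X 0 + c * u) * (4 - 6 * u)) u := by
    intro u
    have := ((((hasDerivAt_id u).const_mul 4).sub
      (((hasDerivAt_id u).pow 2).const_mul 3)).const_mul (X 0)).add
      (((((hasDerivAt_id u).pow 2).const_mul 2).sub
      (((hasDerivAt_id u).pow 3).const_mul 2)).const_mul c)
    refine HasDerivAt.congr_deriv this ?_
    simp only [id]
    push_cast
    ring
  rw [intervalIntegral.integral_eq_sub_of_hasDerivAt (fun u _ => hd u)
    (by apply Continuous.intervalIntegrable; fun_prop)]
  ring

/-- The secant passes through the graph at the zero `2/3` of the weight. By concavity `X` lies above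
it before `2/3` and below it after, so the two factors never have opposite signs. -/
theorem secant_defect_nonneg {X : ℝ → ℝ} (hconc : ConcaveOn ℝ (Icc 0 1) X) {y : ℝ}
    (hy : y ∈ Icc (0 : ℝ) 1) : 0 ≤ (X y - secant X y) * (4 - 6 * y) := by
  rcases le_total y (2 / 3) with h | h
  · have := hconc.2 (left_mem_Icc.2 zero_le_one) (by norm_num : (2 / 3 : ℝ) ∈ Icc (0 : ℝ) 1)
      (by linarith : 0 ≤ 1 - 3 / 2 * y) (by linarith [hy.1] : 0 ≤ 3 / 2 * y) (by ring)
    have e : (1 - 3 / 2 * y) • (0 : ℝ) + (3 / 2 * y) • (2 / 3 : ℝ) = y := by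
      simp only [smul_eq_mul]; ring
    rw [e] at this
    simp only [smul_eq_mul] at this
    refine mul_nonneg ?_ (by linarith)
    simp only [secant]
    linarith
  · have hy0 : 0 < y := by linarith
    have := hconc.2 (left_mem_Icc.2 zero_le_one) hy
      (by rw [sub_nonneg, div_le_one hy0]; exact h : 0 ≤ 1 - 2 / 3 / y)
      (by positivity : 0 ≤ 2 / 3 / y) (by ring)
    have e : (1 - 2 / 3 / y) • (0 : ℝ) + (2 / 3 / y) • y = 2 / 3 := by
      simp only [smul_eq_mul]; field_simp; ring
    rw [e] at this
    simp only [smul_eq_mul] at this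
    refine mul_nonneg_of_nonpos_of_nonpos ?_ (by linarith)
    have h2 := mul_le_mul_of_nonneg_right this hy0.le
    have e2 : ((1 - 2 / 3 / y) * X 0 + 2 / 3 / y * X y) * y =
        (y - 2 / 3) * X 0 + 2 / 3 * X y := by field_simp
    rw [e2] at h2
    simp only [secant]
    linarith

theorem IsProfile.integral_defect_eq {X : ℝ → ℝ} (hX : IsProfile X) :
    (∫ y in (0 : ℝ)..1, X y * (4 - 6 * y)) - X 0 =
      ∫ y in (0 : ℝ)..1, (X y - secant X y) * (4 - 6 * y) := by
  simp only [sub_mul]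
  rw [intervalIntegral.integral_sub (hX.intervalIntegrable_mul (by fun_prop)) (by
    apply Continuous.intervalIntegrable
    unfold secant
    fun_prop), integral_secant_mul]

theorem IsProfile.linearBound_le {X : ℝ → ℝ} (hX : IsProfile X)
    (hconc : ConcaveOn ℝ (Icc 0 1) X) : linearBound X ≤ 3 * radialMoment X := by
  rw [hX.linearBound_eq, hX.integral_defect_eq]
  have := intervalIntegral.integral_nonneg (μ := volume) zero_le_one
    fun y hy => secant_defect_nonneg hconc hy
  linarith

/-- The defect is continuous, nonnegative and of integral at most 0, hence zero, so `X` agrees with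
its secant. At `y = 2/3`, where the weight vanishes, they agree by construction. -/
theorem IsProfile.eq_affine_of_linearBound {X : ℝ → ℝ} (hX : IsProfile X)
    (hconc : ConcaveOn ℝ (Icc 0 1) X) (hcont : ContinuousOn X (Icc 0 1))
    (h : 3 * radialMoment X ≤ linearBound X) :
    ∀ y ∈ Icc (0 : ℝ) 1, X y = X 1 + (X 0 - X 1) * (1 - y) := by
  rw [hX.linearBound_eq, hX.integral_defect_eq] at h
  have hz : ∀ y ∈ Icc (0 : ℝ) 1, (X y - secant X y) * (4 - 6 * y) = 0 := by
    by_contra! hne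
    obtain ⟨y, hy, hy0⟩ := hne
    have := intervalIntegral.integral_pos (a := 0) (b := 1)
      (f := fun y => (X y - secant X y) * (4 - 6 * y)) one_pos
      ((hcont.sub (by unfold secant; fun_prop)).mul (by fun_prop))
      (fun z hz => secant_defect_nonneg hconc (Ioc_subset_Icc_self hz))
      ⟨y, hy, lt_of_le_of_ne (secant_defect_nonneg hconc hy) hy0.symm⟩
    linarith
  have hs : ∀ y ∈ Icc (0 : ℝ) 1, X y = secant X y := by
    intro y hy
    rcases mul_eq_zero.1 (hz y hy) with h | h
    · linarith
    · have : y = 2 / 3 := by linarith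
      rw [this]
      simp only [secant]
      ring
  intro y hy
  have h1 := hs 1 (right_mem_Icc.2 zero_le_one)
  rw [hs y hy]
  simp only [secant] at h1 ⊢
  rw [h1]
  ring

theorem IsProfile.one_le_mul {X : ℝ → ℝ} (hX : IsProfile X)
    (hconc : ConcaveOn ℝ (Icc 0 1) X) (hcont : ContinuousOn X (Icc 0 1)) :
    1 ≤ polarMoment X * (3 * radialMoment X) :=
  (hX.one_le_polarMoment_mul_linearBound hconc hcont).trans
    (mul_le_mul_of_nonneg_left (hX.linearBound_le hconc) hX.polarMoment_pos.le)

theorem IsProfile.eq_affine_of_mul_eq_one {X : ℝ → ℝ} (hX : IsProfile X)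
    (hconc : ConcaveOn ℝ (Icc 0 1) X) (hcont : ContinuousOn X (Icc 0 1))
    (h : polarMoment X * (3 * radialMoment X) = 1) :
    ∀ y ∈ Icc (0 : ℝ) 1, X y = X 1 + (X 0 - X 1) * (1 - y) := by
  refine hX.eq_affine_of_linearBound hconc hcont ?_
  have := hX.one_le_polarMoment_mul_linearBound hconc hcont
  rw [← h] at this
  exact le_of_mul_le_mul_left this hX.polarMoment_pos

theorem IsProfile.mul_of_affine {X : ℝ → ℝ} (hX : IsProfile X)
    (h : ∀ y ∈ Icc (0 : ℝ) 1, X y = X 1 + (X 0 - X 1) * (1 - y)) :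
    polarMoment X * (3 * radialMoment X) =
      1 + X 1 / X 0 * (1 - X 1 / X 0) * (3 - 2 * (X 1 / X 0)) / 3 := by
  have h10 : X 1 ≤ X 0 := hX.le_zero (right_mem_Icc.2 zero_le_one)
  have h1 : 0 ≤ X 1 := hX.nonneg 1 (right_mem_Icc.2 zero_le_one)
  have ha := hX.pos
  obtain ⟨α, hα⟩ : ∃ α, X 1 = α := ⟨_, rfl⟩
  obtain ⟨a, haa⟩ : ∃ a, X 0 = a := ⟨_, rfl⟩
  have hA : radialMoment X = α + (a - α) / 3 := by
    have : radialMoment X = ∫ y in (0 : ℝ)..1, 2 * y * (α + (a - α) * (1 - y)) := by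
      refine intervalIntegral.integral_congr fun y hy => ?_
      rw [uIcc_of_le zero_le_one] at hy
      simp only [h y hy, hα, haa]
    rw [this]
    have hd : ∀ u, HasDerivAt (fun u => a * u ^ 2 - 2 / 3 * (a - α) * u ^ 3)
        (2 * u * (α + (a - α) * (1 - u))) u := by
      intro u
      have := (((hasDerivAt_id u).pow 2).const_mul a).sub
        (((hasDerivAt_id u).pow 3).const_mul (2 / 3 * (a - α)))
      refine HasDerivAt.congr_deriv this ?_
      simp only [id]
      push_cast
      ring
    rw [intervalIntegral.integral_eq_sub_of_hasDerivAt (fun u _ => hd u)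
      (by apply Continuous.intervalIntegrable; fun_prop)]
    ring
  have hB : polarMoment X = (3 - 3 * (α / a) + (α / a) ^ 2) / (3 * a) := by
    have : polarMoment X = ∫ u in (0)..(1 / a), (1 - u * α) ^ 2 := by
      rw [polarMoment, haa]
      refine intervalIntegral.integral_congr fun u hu => ?_
      rw [haa] at ha
      rw [uIcc_of_le (one_div_pos.2 ha).le, ← haa] at hu
      have hua := (le_div_iff₀ hX.pos).1 hu.2
      have huα := mul_le_mul_of_nonneg_left h10 hu.1
      -- For affine `X` only the constraints at `y = 0` and `y = 1` matter; the first holds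
      -- throughout `u ≤ 1 / X 0`, so the second determines the profile.
      have : polarProfile X u = 1 - u * α := by
        apply le_antisymm
        · have := (hX.polarProfile_spec hu).2 1 (right_mem_Icc.2 zero_le_one)
          rw [hα] at this
          linarith
        · rw [← hα]
          refine hX.le_polarProfile hu.1 (by linarith) fun y hy => ?_
          rw [h y hy]
          nlinarith [hy.1, hy.2, mul_nonneg (sub_nonneg.2 hua) (sub_nonneg.2 hy.2)]
      simp only [this]
    rw [this]
    have hd : ∀ u, HasDerivAt (fun u => u - α * u ^ 2 + α ^ 2 / 3 * u ^ 3)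
        ((1 - u * α) ^ 2) u := by
      intro u
      have := ((hasDerivAt_id u).sub (((hasDerivAt_id u).pow 2).const_mul α)).add
        (((hasDerivAt_id u).pow 3).const_mul (α ^ 2 / 3))
      refine HasDerivAt.congr_deriv this ?_
      simp only [id]
      push_cast
      ring
    rw [intervalIntegral.integral_eq_sub_of_hasDerivAt (fun u _ => hd u)
      (by apply Continuous.intervalIntegrable; fun_prop)]
    rw [haa] at ha
    field_simp
    ring
  rw [hA, hB, hα, haa]
  rw [haa] at ha
  field_simp
  ring

/-! ### Volumes of solids of revolution. -/

/-- The solid of revolution with half-length `c` and radius function `φ`. -/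
def solid (c : ℝ) (φ : ℝ → ℝ) : Set E3 :=
  {p | |p 0| ≤ c ∧ p 1 ^ 2 + p 2 ^ 2 ≤ φ |p 0| ^ 2}

theorem volume_disc {r : ℝ} (hr : 0 ≤ r) :
    volume {q : Fin 2 → ℝ | q 0 ^ 2 + q 1 ^ 2 ≤ r ^ 2} = ENNReal.ofReal (Real.pi * r ^ 2) := by
  have h := (EuclideanSpace.volume_preserving_symm_measurableEquiv_toLp (Fin 2)).symm
  have e : (MeasurableEquiv.toLp 2 (Fin 2 → ℝ)).symm.symm ⁻¹'
      (Metric.closedBall (0 : EuclideanSpace ℝ (Fin 2)) r) =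
      {q : Fin 2 → ℝ | q 0 ^ 2 + q 1 ^ 2 ≤ r ^ 2} := by
    ext q
    simp only [mem_preimage, mem_closedBall_zero_iff, mem_ofPred_eq, EuclideanSpace.norm_eq,
      Fin.sum_univ_two, Real.norm_eq_abs, sq_abs]
    exact Real.sqrt_le_left hr
  rw [← e, h.measure_preimage_equiv, EuclideanSpace.volume_closedBall_fin_two,
    ← ENNReal.ofReal_pow hr]
  rw [mul_comm Real.pi, ENNReal.ofReal_mul (by positivity)]

theorem volume_real_solid {c : ℝ} (hc : 0 < c) {φ : ℝ → ℝ} (hφ : AntitoneOn φ (Icc 0 c))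
    (hφ0 : ∀ u ∈ Icc 0 c, 0 ≤ φ u) :
    volume.real (solid c φ) = 2 * Real.pi * ∫ u in (0)..c, φ u ^ 2 := by
  -- Replacing the radius function by a globally monotone extension makes it measurable without
  -- changing the solid.
  obtain ⟨g, hg, hgφ⟩ := hφ.exists_antitone_extension
    ⟨φ c, by rintro _ ⟨u, hu, rfl⟩; exact hφ hu (right_mem_Icc.2 hc.le) hu.2⟩
    ⟨φ 0, by rintro _ ⟨u, hu, rfl⟩; exact hφ (left_mem_Icc.2 hc.le) hu hu.1⟩
  have hgm : Measurable g := hg.measurable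
  set s : Set (ℝ × (Fin 2 → ℝ)) := {q | |q.1| ≤ c ∧ q.2 0 ^ 2 + q.2 1 ^ 2 ≤ g |q.1| ^ 2} with hs
  have hsm : MeasurableSet s := by
    have e1 : Measurable fun q : ℝ × (Fin 2 → ℝ) => |q.1| := by fun_prop
    have e2 : Measurable fun q : ℝ × (Fin 2 → ℝ) => q.2 0 ^ 2 + q.2 1 ^ 2 := by fun_prop
    have e3 : Measurable fun q : ℝ × (Fin 2 → ℝ) => g |q.1| ^ 2 := by fun_prop
    exact (measurableSet_le e1 measurable_const).inter (measurableSet_le e2 e3)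
  have h1 := EuclideanSpace.volume_preserving_symm_measurableEquiv_toLp (Fin 3)
  have h2 := volume_preserving_piFinSuccAbove (fun _ : Fin 3 => ℝ) 0
  have hpre : solid c φ = (MeasurableEquiv.toLp 2 (Fin 3 → ℝ)).symm ⁻¹'
      ((MeasurableEquiv.piFinSuccAbove (fun _ : Fin 3 => ℝ) 0) ⁻¹' s) := by
    ext p
    simp only [solid, hs, mem_ofPred_eq, mem_preimage]
    refine and_congr_right fun hp => ?_
    rw [hgφ ⟨abs_nonneg _, hp⟩]
    rfl
  have hvol : volume (solid c φ) = volume s := by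
    rw [hpre, h1.measure_preimage_equiv, h2.measure_preimage_equiv]
  have hslice : ∀ x, volume (Prod.mk x ⁻¹' s) =
      (Icc (-c) c).indicator (fun x => ENNReal.ofReal (Real.pi * g |x| ^ 2)) x := by
    intro x
    by_cases hx : |x| ≤ c
    · rw [indicator_of_mem (show x ∈ Icc (-c) c from abs_le.1 hx)]
      have : Prod.mk x ⁻¹' s = {q : Fin 2 → ℝ | q 0 ^ 2 + q 1 ^ 2 ≤ g |x| ^ 2} := by
        ext q
        simp [hs, hx]
      have hm : |x| ∈ Icc 0 c := ⟨abs_nonneg _, hx⟩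
      rw [this, volume_disc (by rw [← hgφ hm]; exact hφ0 _ hm)]
    · rw [indicator_of_notMem (show x ∉ Icc (-c) c from fun h => hx (abs_le.2 h))]
      have : Prod.mk x ⁻¹' s = ∅ := by
        ext q
        simp [hs, hx]
      simp [this]
  have hgi : IntegrableOn (fun x => g |x| ^ 2) (Icc (-c) c) := by
    refine Measure.integrableOn_of_bounded (M := φ 0 ^ 2) (by simp)
      (by fun_prop : Measurable fun x => g |x| ^ 2).aestronglyMeasurable ?_
    filter_upwards [ae_restrict_mem measurableSet_Icc] with x hx
    have hm : |x| ∈ Icc 0 c := ⟨abs_nonneg _, abs_le.2 hx⟩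
    rw [Real.norm_eq_abs, abs_pow, sq_abs, ← hgφ hm]
    exact pow_le_pow_left₀ (hφ0 _ hm) (hφ (left_mem_Icc.2 hc.le) hm hm.1) 2
  have hgi' : ∀ p ∈ Icc (-c) c, ∀ q ∈ Icc (-c) c,
      IntervalIntegrable (fun x => g |x| ^ 2) volume p q := fun p hp q hq =>
    (intervalIntegrable_iff.2 (hgi.mono_set (uIoc_subset_uIcc.trans (uIcc_subset_Icc hp hq))))
  have hm0 : (0 : ℝ) ∈ Icc (-c) c := ⟨by linarith, hc.le⟩
  have habs : ∫ x in (-c)..c, g |x| ^ 2 = 2 * ∫ u in (0)..c, g u ^ 2 := by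
    have h3 : ∫ x in (0)..c, g |x| ^ 2 = ∫ u in (0)..c, g u ^ 2 := by
      refine intervalIntegral.integral_congr fun x hx => ?_
      rw [uIcc_of_le hc.le] at hx
      simp only [abs_of_nonneg hx.1]
    have h4 : ∫ x in (-c)..0, g |x| ^ 2 = ∫ u in (0)..c, g |u| ^ 2 := by
      have := intervalIntegral.integral_comp_neg (a := 0) (b := c) (fun x => g |x| ^ 2)
      simp only [abs_neg, neg_zero] at this
      exact this.symm
    rw [← intervalIntegral.integral_add_adjacent_intervals 
      (hgi' _ (left_mem_Icc.2 (by linarith)) _ hm0) (hgi' _ hm0 _ (right_mem_Icc.2 (by linarith))), h4, h3]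
    ring
  have hle : -c ≤ c := by linarith
  rw [Measure.real, hvol, Measure.volume_eq_prod, Measure.prod_apply hsm]
  simp_rw [hslice]
  rw [lintegral_indicator measurableSet_Icc, ← ofReal_integral_eq_lintegral_ofReal,
    ENNReal.toReal_ofReal]
  · rw [integral_const_mul, integral_Icc_eq_integral_Ioc, ← intervalIntegral.integral_of_le hle,
      habs]
    have : ∫ u in (0)..c, φ u ^ 2 = ∫ u in (0)..c, g u ^ 2 := by
      refine intervalIntegral.integral_congr fun x hx => ?_
      rw [uIcc_of_le hc.le] at hx
      simp only [hgφ hx]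
    rw [this]
    ring
  · exact integral_nonneg fun x => by positivity
  · exact hgi.const_mul _
  · exact Filter.Eventually.of_forall fun x => by positivity

theorem revolve_generatingDomain {a : ℝ} {f : ℝ → ℝ} (heven : ∀ x ∈ Icc (-a) a, f (-x) = f x)
    (hf : ∀ x ∈ Icc (-a) a, 0 ≤ f x) : revolve (generatingDomain a f) = solid a f := by
  have habs : ∀ x ∈ Icc (-a) a, f |x| = f x := by
    intro x hx
    rcases abs_cases x with ⟨h, -⟩ | ⟨h, -⟩ <;> rw [h]
    exact heven x hx
  ext p
  constructor
  · rintro ⟨⟨x, y⟩, ⟨h1, h2, h3⟩, θ, rfl⟩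
    simp only at h1 h2 h3
    simp only [solid, mem_ofPred_eq]
    simp
    refine ⟨abs_le.2 ⟨h1, h2⟩, ?_⟩
    rw [habs x ⟨h1, h2⟩]
    calc (y * Real.cos θ) ^ 2 + (y * Real.sin θ) ^ 2 = y ^ 2 := by
          linear_combination y ^ 2 * Real.sin_sq_add_cos_sq θ
      _ ≤ f x ^ 2 := sq_le_sq' (abs_le.1 h3).1 (abs_le.1 h3).2
  · rintro ⟨h1, h2⟩
    have hx := abs_le.1 h1
    rw [habs _ hx] at h2
    set z : ℂ := ⟨p 1, p 2⟩ with hz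
    refine ⟨(p 0, ‖z‖), ⟨hx.1, hx.2, ?_⟩, z.arg, ?_⟩
    · simp only [abs_norm]
      refine abs_le_of_sq_le_sq' ?_ (hf _ hx) |>.2
      rw [← Complex.normSq_eq_norm_sq, Complex.normSq_apply]
      simpa [hz, sq] using h2
    · ext i
      fin_cases i
      · rfl
      · simp [Complex.norm_mul_cos_arg, hz]
      · simp [Complex.norm_mul_sin_arg, hz]

/-! ### Half-width functions, and both volumes expressed through them. -/

/-- Radius functions on the right half of the axis. -/
structure IsRadius (a : ℝ) (f : ℝ → ℝ) : Prop where
  pos : 0 < a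
  concave : ConcaveOn ℝ (Icc 0 a) f
  antitone : AntitoneOn f (Icc 0 a)
  nonneg : ∀ x ∈ Icc 0 a, 0 ≤ f x
  center : 0 < f 0

/-- The half-width at normalised radius `y`. -/
def halfWidth (a : ℝ) (f : ℝ → ℝ) (y : ℝ) : ℝ := sSup {x | x ∈ Icc 0 a ∧ f 0 * y ≤ f x}

namespace IsRadius

variable {a : ℝ} {f : ℝ → ℝ} {x y : ℝ}

theorem zero_mem (h : IsRadius a f) : (0 : ℝ) ∈ Icc 0 a := left_mem_Icc.2 h.pos.le

theorem end_mem (h : IsRadius a f) : a ∈ Icc 0 a := right_mem_Icc.2 h.pos.le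

theorem le_center (h : IsRadius a f) (hx : x ∈ Icc 0 a) : f x ≤ f 0 :=
  h.antitone h.zero_mem hx hx.1

theorem level_nonempty (h : IsRadius a f) (hy : y ∈ Icc (0 : ℝ) 1) :
    {x | x ∈ Icc 0 a ∧ f 0 * y ≤ f x}.Nonempty :=
  ⟨0, h.zero_mem, mul_le_of_le_one_right h.center.le hy.2⟩

theorem le_halfWidth (hx : x ∈ Icc 0 a) (hxy : f 0 * y ≤ f x) : x ≤ halfWidth a f y :=
  le_csSup ⟨a, fun _ hz => hz.1.2⟩ ⟨hx, hxy⟩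

theorem halfWidth_mem (h : IsRadius a f) (hy : y ∈ Icc (0 : ℝ) 1) : halfWidth a f y ∈ Icc 0 a :=
  ⟨le_halfWidth h.zero_mem (mul_le_of_le_one_right h.center.le hy.2),
    csSup_le (h.level_nonempty hy) fun _ hz => hz.1.2⟩

theorem le_of_lt_halfWidth (h : IsRadius a f) (hy : y ∈ Icc (0 : ℝ) 1) (hx : 0 ≤ x)
    (hxy : x < halfWidth a f y) : f 0 * y ≤ f x := by
  obtain ⟨z, ⟨hz, hzy⟩, hxz⟩ := exists_lt_of_lt_csSup (h.level_nonempty hy) hxy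
  exact hzy.trans (h.antitone ⟨hx, hxz.le.trans hz.2⟩ hz hxz.le)

theorem halfWidth_zero (h : IsRadius a f) : halfWidth a f 0 = a :=
  le_antisymm (h.halfWidth_mem (left_mem_Icc.2 zero_le_one)).2
    (le_halfWidth h.end_mem (by simpa using h.nonneg a h.end_mem))

theorem antitoneOn_halfWidth (h : IsRadius a f) : AntitoneOn (halfWidth a f) (Icc 0 1) := by
  intro y _ z hz hyz
  refine csSup_le (h.level_nonempty hz) fun x hx => le_halfWidth hx.1 (le_trans ?_ hx.2)
  exact mul_le_mul_of_nonneg_left hyz h.center.le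

theorem isProfile_halfWidth (h : IsRadius a f) : IsProfile (halfWidth a f) where
  antitone := h.antitoneOn_halfWidth
  nonneg _ hy := (h.halfWidth_mem hy).1
  pos := by rw [h.halfWidth_zero]; exact h.pos

theorem concaveOn_halfWidth (h : IsRadius a f) : ConcaveOn ℝ (Icc 0 1) (halfWidth a f) := by
  refine ⟨convex_Icc _ _, fun y hy z hz p q hp hq hpq => ?_⟩
  refine le_of_forall_pos_le_add fun ε hε => ?_
  obtain ⟨x₁, ⟨hx₁, hxy₁⟩, hlt₁⟩ := exists_lt_of_lt_csSup (h.level_nonempty hy)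
    (sub_lt_self (halfWidth a f y) hε)
  obtain ⟨x₂, ⟨hx₂, hxy₂⟩, hlt₂⟩ := exists_lt_of_lt_csSup (h.level_nonempty hz)
    (sub_lt_self (halfWidth a f z) hε)
  have hc := h.concave.2 hx₁ hx₂ hp hq hpq
  have hm := convex_Icc 0 a hx₁ hx₂ hp hq hpq
  simp only [smul_eq_mul] at hc hm ⊢
  have h1 : p * x₁ + q * x₂ ≤ halfWidth a f (p * y + q * z) := by
    refine le_halfWidth hm (le_trans ?_ hc)
    nlinarith [mul_le_mul_of_nonneg_left hxy₁ hp, mul_le_mul_of_nonneg_left hxy₂ hq]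
  have h2 := mul_le_mul_of_nonneg_left hlt₁.le hp
  have h3 := mul_le_mul_of_nonneg_left hlt₂.le hq
  have h4 : p * ε + q * ε = ε := by rw [← add_mul, hpq, one_mul]
  linarith

/-- Concavity gives the interior, and the chord together with monotonicity gives the endpoint 0. At
1, a jump would leave some `w` above the half-width with `f w ≥ f 0 * b` for every `b < 1`, hence `f
w ≥ f 0`, a contradiction. -/
theorem continuousOn_halfWidth (h : IsRadius a f) : ContinuousOn (halfWidth a f) (Icc 0 1) := by
  intro y hy
  rcases hy.1.eq_or_lt with rfl | hy0
  · have hlow : ContinuousWithinAt (fun y => (1 - y) * halfWidth a f 0 + y * halfWidth a f 1)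
        (Icc 0 1) (0 : ℝ) := by fun_prop
    have hlow' : Filter.Tendsto (fun y => (1 - y) * halfWidth a f 0 + y * halfWidth a f 1)
        (nhdsWithin 0 (Icc 0 1)) (nhds (halfWidth a f 0)) := by
      simpa [ContinuousWithinAt] using hlow
    refine tendsto_of_tendsto_of_tendsto_of_le_of_le' hlow' tendsto_const_nhds ?_ ?_
    · filter_upwards [self_mem_nhdsWithin] with y hy
      have := h.concaveOn_halfWidth.2 (left_mem_Icc.2 zero_le_one) (right_mem_Icc.2 zero_le_one)
        (sub_nonneg.2 hy.2) hy.1 (by ring)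
      simpa using this
    · filter_upwards [self_mem_nhdsWithin] with y hy
      exact h.antitoneOn_halfWidth (left_mem_Icc.2 zero_le_one) hy hy.1
  rcases hy.2.eq_or_lt with rfl | hy1
  · rw [ContinuousWithinAt, tendsto_order]
    refine ⟨fun c hc => ?_, fun c hc => ?_⟩
    · filter_upwards [self_mem_nhdsWithin] with y hy
      exact hc.trans_le (h.antitoneOn_halfWidth hy (right_mem_Icc.2 zero_le_one) hy.2)
    · by_cases hex : ∃ z ∈ Ico (0 : ℝ) 1, halfWidth a f z < c
      · obtain ⟨z, hz, hzc⟩ := hex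
        filter_upwards [self_mem_nhdsWithin, mem_nhdsWithin_of_mem_nhds (Ioi_mem_nhds hz.2)]
          with y hy hzy
        exact (h.antitoneOn_halfWidth (Ico_subset_Icc_self hz) hy (le_of_lt hzy)).trans_lt hzc
      · exfalso
        push Not at hex
        obtain ⟨w, hw1, hw2⟩ := exists_between hc
        have hw0 : 0 ≤ w := (h.halfWidth_mem hy).1.trans hw1.le
        have hwa : w ≤ a := by
          have := hex 0 ⟨le_rfl, one_pos⟩
          rw [h.halfWidth_zero] at this
          exact hw2.le.trans this
        have hfw : f 0 * 1 ≤ f w := by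
          refine le_of_forall_lt_imp_le_of_dense fun b hb => ?_
          rcases le_or_gt b 0 with hb0 | hb0
          · exact hb0.trans (h.nonneg w ⟨hw0, hwa⟩)
          · have hmem : b / f 0 ∈ Ico (0 : ℝ) 1 :=
              ⟨by have := h.center; positivity, (div_lt_one h.center).2 (by linarith)⟩
            have := h.le_of_lt_halfWidth (Ico_subset_Icc_self hmem) hw0
              (hw2.trans_le (hex _ hmem))
            rwa [mul_div_cancel₀ _ h.center.ne'] at this
        linarith [le_halfWidth ⟨hw0, hwa⟩ hfw]
  · have := h.concaveOn_halfWidth.continuousOn_interior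
    rw [interior_Icc] at this
    exact (this.continuousAt (Ioo_mem_nhds hy0 hy1)).continuousWithinAt

/-- Layer-cake formula for the square of `f / f 0`: up to endpoints, the level set at height `t ≤ 1`
is an interval of length `halfWidth a f t`. -/
theorem integral_sq (h : IsRadius a f) :
    ∫ x in (0)..a, f x ^ 2 = f 0 ^ 2 * radialMoment (halfWidth a f) := by
  set μ : Measure ℝ := volume.restrict (Ioc 0 a) with hμ
  set φ : ℝ → ℝ := fun x => f x / f 0 with hφ
  have hsub : Ioc 0 a ⊆ Icc 0 a := Ioc_subset_Icc_self
  have hφm : AEMeasurable φ μ :=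
    (aemeasurable_restrict_of_antitoneOn measurableSet_Ioc (h.antitone.mono hsub)).div_const _
  have hφ0 : 0 ≤ᵐ[μ] φ := by
    filter_upwards [ae_restrict_mem measurableSet_Ioc] with x hx
    exact div_nonneg (h.nonneg x (hsub hx)) h.center.le
  have hcake := lintegral_comp_eq_lintegral_meas_le_mul (g := fun t : ℝ => 2 * t) μ hφ0 hφm
    (fun t _ => by apply Continuous.intervalIntegrable; fun_prop) (by
      filter_upwards [ae_restrict_mem measurableSet_Ioi] with t ht
      have := mem_Ioi.1 ht
      positivity)
  have hg : ∀ s : ℝ, ∫ t in (0)..s, 2 * t = s ^ 2 := by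
    intro s
    rw [intervalIntegral.integral_const_mul, integral_id]
    ring
  simp only [hg] at hcake
  have hlevel : ∀ t ∈ Ioi (0 : ℝ), μ {x | t ≤ φ x} * ENNReal.ofReal (2 * t) =
      (Ioc (0 : ℝ) 1).indicator (fun t => ENNReal.ofReal (2 * t * halfWidth a f t)) t := by
    intro t ht
    have ht0 : 0 < t := ht
    rw [hμ, Measure.restrict_apply' measurableSet_Ioc]
    by_cases ht1 : t ≤ 1
    · rw [indicator_of_mem (show t ∈ Ioc (0 : ℝ) 1 from ⟨ht0, ht1⟩)]
      have htm : t ∈ Icc (0 : ℝ) 1 := ⟨ht0.le, ht1⟩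
      have hle : volume ({x | t ≤ φ x} ∩ Ioc 0 a) ≤ ENNReal.ofReal (halfWidth a f t) := by
        have : {x | t ≤ φ x} ∩ Ioc 0 a ⊆ Ioc 0 (halfWidth a f t) := by
          rintro x ⟨hx, hxa⟩
          refine ⟨hxa.1, le_halfWidth (hsub hxa) ?_⟩
          have := (le_div_iff₀ h.center).1 hx
          linarith
        simpa using measure_mono (μ := volume) this
      have hge : ENNReal.ofReal (halfWidth a f t) ≤ volume ({x | t ≤ φ x} ∩ Ioc 0 a) := by
        have : Ioo 0 (halfWidth a f t) ⊆ {x | t ≤ φ x} ∩ Ioc 0 a := by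
          rintro x ⟨hx0, hx⟩
          refine ⟨?_, hx0, hx.le.trans (h.halfWidth_mem htm).2⟩
          refine (le_div_iff₀ h.center).2 ?_
          have := h.le_of_lt_halfWidth htm hx0.le hx
          linarith
        simpa using measure_mono (μ := volume) this
      rw [le_antisymm hle hge, mul_comm, ← ENNReal.ofReal_mul (by positivity)]
    · rw [indicator_of_notMem (fun hh => ht1 hh.2)]
      have : {x | t ≤ φ x} ∩ Ioc 0 a = ∅ := by
        refine eq_empty_of_forall_notMem ?_
        rintro x ⟨hx, hxa⟩
        have h1 : t ≤ f x / f 0 := hx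
        have := (div_le_one h.center).2 (h.le_center (hsub hxa))
        exact ht1 (h1.trans this)
      simp [this]
  rw [setLIntegral_congr_fun measurableSet_Ioi hlevel,
    lintegral_indicator measurableSet_Ioc, Measure.restrict_restrict measurableSet_Ioc,
    inter_eq_left.2 Ioc_subset_Ioi_self] at hcake
  have h1 : ∫ x in (0)..a, φ x ^ 2 = radialMoment (halfWidth a f) := by
    rw [intervalIntegral.integral_of_le h.pos.le, radialMoment,
      intervalIntegral.integral_of_le zero_le_one,
      integral_eq_lintegral_of_nonneg_ae (Filter.Eventually.of_forall fun x => sq_nonneg _)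
        (hφm.pow_const 2).aestronglyMeasurable, hcake,
      integral_eq_lintegral_of_nonneg_ae]
    · filter_upwards [ae_restrict_mem measurableSet_Ioc] with t ht
      exact mul_nonneg (by linarith [ht.1])
        (h.halfWidth_mem (Ioc_subset_Icc_self ht)).1
    · refine AEMeasurable.aestronglyMeasurable (AEMeasurable.mul (by fun_prop) ?_)
      exact aemeasurable_restrict_of_antitoneOn measurableSet_Ioc
        (h.antitoneOn_halfWidth.mono Ioc_subset_Icc_self)
  rw [← h1, ← intervalIntegral.integral_const_mul]
  congr 1
  ext x
  have := h.center
  simp only [hφ]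
  field_simp

/-- With `ρ` the distance of `p` from the axis, rotation and reflection reduce membership to `|p 0|
* x + ρ * f x ≤ 1` for `x ∈ [0, a]`. Indexing by the level `y = f x / f 0` instead of by `x` turns
this into the constraint defining `polarProfile`, with `v = ρ * f 0`. -/
theorem polarBody_solid (h : IsRadius a f) :
    polarBody (solid a f) =
      solid (1 / a) (fun u => polarProfile (halfWidth a f) u / f 0) := by
  have hP := h.isProfile_halfWidth
  have hH0 := h.halfWidth_zero
  have hf0 := h.center
  have hinner : ∀ p q : E3, inner ℝ p q = p 0 * q 0 + (p 1 * q 1 + p 2 * q 2) := by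
    intro p q
    simp only [PiLp.inner_apply, Fin.sum_univ_three, RCLike.inner_apply, conj_trivial]
    ring
  ext p
  set ρ := Real.sqrt (p 1 ^ 2 + p 2 ^ 2) with hρ
  have hρ0 : 0 ≤ ρ := Real.sqrt_nonneg _
  have hρsq : ρ ^ 2 = p 1 ^ 2 + p 2 ^ 2 := Real.sq_sqrt (by positivity)
  constructor
  · intro hp
    have key : ∀ x ∈ Icc 0 a, |p 0| * x + ρ * f x ≤ 1 := by
      intro x hx
      set σ : ℝ := if 0 ≤ p 0 then 1 else -1 with hσ
      have hσ1 : |σ| = 1 := by rw [hσ]; split_ifs <;> simp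
      have hσ2 : p 0 * σ = |p 0| := by
        rw [hσ]
        split_ifs with h0
        · rw [abs_of_nonneg h0, mul_one]
        · rw [abs_of_neg (not_le.1 h0)]; ring
      have hr : (p 1 / ρ) ^ 2 + (p 2 / ρ) ^ 2 ≤ 1 := by
        rw [div_pow, div_pow, ← add_div, ← hρsq]
        exact div_self_le_one _
      have hr' : p 1 * (p 1 / ρ) + p 2 * (p 2 / ρ) = ρ := by
        rcases hρ0.eq_or_lt with h0 | h0
        · rw [← h0]; simp
        · field_simp
          exact hρsq.symm
      -- The test point is the boundary point aligned with `p`. If `ρ = 0` the quotients are 0 by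
      -- convention and it lies on the axis, which suffices.
      have hmem : (!₂[σ * x, f x * (p 1 / ρ), f x * (p 2 / ρ)] : E3) ∈ solid a f := by
        simp only [solid, mem_ofPred_eq]
        have e : |σ * x| = x := by rw [abs_mul, hσ1, one_mul, abs_of_nonneg hx.1]
        simp only [Matrix.cons_val_zero, Matrix.cons_val_one, Matrix.cons_val]
        rw [e]
        refine ⟨hx.2, ?_⟩
        calc (f x * (p 1 / ρ)) ^ 2 + (f x * (p 2 / ρ)) ^ 2
            = f x ^ 2 * ((p 1 / ρ) ^ 2 + (p 2 / ρ) ^ 2) := by ring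
          _ ≤ f x ^ 2 := mul_le_of_le_one_right (sq_nonneg _) hr
      have := hp _ hmem
      rw [hinner] at this
      simp only [Matrix.cons_val_zero, Matrix.cons_val_one, Matrix.cons_val]
        at this
      calc |p 0| * x + ρ * f x = p 0 * (σ * x) +
            (p 1 * (f x * (p 1 / ρ)) + p 2 * (f x * (p 2 / ρ))) := by
            linear_combination (-x) * hσ2 - f x * hr'
        _ ≤ 1 := this
    have hpa : |p 0| ≤ 1 / a := by
      rw [le_div_iff₀ h.pos]
      have := key a h.end_mem
      have := mul_nonneg hρ0 (h.nonneg a h.end_mem)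
      linarith
    refine ⟨hpa, ?_⟩
    have hle : ρ * f 0 ≤ polarProfile (halfWidth a f) |p 0| := by
      refine hP.le_polarProfile (abs_nonneg _) (by positivity) fun y hy => ?_
      have hx : ∀ x ∈ Icc 0 a, f 0 * y ≤ f x → |p 0| * x + ρ * f 0 * y ≤ 1 := by
        intro x hx hxy
        have := mul_le_mul_of_nonneg_left hxy hρ0
        linarith [key x hx]
      -- Passing to the supremum over `x` divides by `|p 0|`; if that is 0, the constraint at `x =
      -- 0` alone is enough.
      rcases (abs_nonneg (p 0)).eq_or_lt with h0 | h0
      · have := hx 0 h.zero_mem (mul_le_of_le_one_right hf0.le hy.2)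
        rw [← h0] at this ⊢
        linarith
      · have : halfWidth a f y ≤ (1 - ρ * f 0 * y) / |p 0| := by
          refine csSup_le (h.level_nonempty hy) fun x hxy => ?_
          rw [le_div_iff₀ h0]
          linarith [hx x hxy.1 hxy.2]
        rw [le_div_iff₀ h0] at this
        linarith
    rw [← hρsq]
    exact pow_le_pow_left₀ hρ0 ((le_div_iff₀ hf0).2 hle) 2
  · rintro ⟨hp1, hp2⟩ q ⟨hq1, hq2⟩
    have hu : |p 0| ∈ Icc 0 (1 / halfWidth a f 0) := by
      rw [hH0]
      exact ⟨abs_nonneg _, hp1⟩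
    have hspec := hP.polarProfile_spec hu
    have hqm : |q 0| ∈ Icc 0 a := ⟨abs_nonneg _, hq1⟩
    have hρle : ρ * f 0 ≤ polarProfile (halfWidth a f) |p 0| := by
      rw [← le_div_iff₀ hf0]
      refine abs_le_of_sq_le_sq' ?_ (div_nonneg hspec.1 hf0.le) |>.2
      rw [hρsq]
      exact hp2
    have hy : f |q 0| / f 0 ∈ Icc (0 : ℝ) 1 :=
      ⟨div_nonneg (h.nonneg _ hqm) hf0.le, (div_le_one hf0).2 (h.le_center hqm)⟩
    have hxH : |q 0| ≤ halfWidth a f (f |q 0| / f 0) :=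
      le_halfWidth hqm (by rw [mul_div_cancel₀ _ hf0.ne'])
    have h1 := hspec.2 _ hy
    have h2 := mul_le_mul_of_nonneg_left hxH (abs_nonneg (p 0))
    have h3 := mul_le_mul_of_nonneg_right hρle hy.1
    have h3' : ρ * f 0 * (f |q 0| / f 0) = ρ * f |q 0| := by field_simp
    have h4 : p 0 * q 0 ≤ |p 0| * |q 0| := by rw [← abs_mul]; exact le_abs_self _
    have h5 : p 1 * q 1 + p 2 * q 2 ≤ ρ * f |q 0| := by
      refine abs_le_of_sq_le_sq' ?_ (mul_nonneg hρ0 (h.nonneg _ hqm)) |>.2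
      rw [mul_pow, hρsq]
      refine le_trans ?_ (mul_le_mul_of_nonneg_left hq2 (by positivity))
      nlinarith [sq_nonneg (p 1 * q 2 - p 2 * q 1)]
    rw [hinner]
    linarith

theorem mahlerVolume_solid (h : IsRadius a f) :
    mahlerVolume (solid a f) = 4 * Real.pi ^ 2 / 3 *
      (polarMoment (halfWidth a f) * (3 * radialMoment (halfWidth a f))) := by
  have hP := h.isProfile_halfWidth
  have hf0 := h.center
  have hH0 := h.halfWidth_zero
  have hanti := hP.antitoneOn_polarProfile
  have hspec := fun u (hu : u ∈ Icc 0 (1 / halfWidth a f 0)) => (hP.polarProfile_spec hu).1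
  rw [hH0] at hanti hspec
  rw [mahlerVolume, h.polarBody_solid, volume_real_solid h.pos h.antitone h.nonneg, h.integral_sq,
    volume_real_solid (one_div_pos.2 h.pos)
      (fun u hu w hw huw => div_le_div_of_nonneg_right (hanti hu hw huw) hf0.le)
      fun u hu => div_nonneg (hspec u hu) hf0.le]
  simp only [div_pow]
  rw [intervalIntegral.integral_div, polarMoment, hH0]
  field_simp
  ring

end IsRadius

/-! ### From generated convex bodies to the inequality and its equality cases. -/

namespace IsGeneratedBy

variable {K : ConvexBody E3} {a : ℝ} {f : ℝ → ℝ}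

theorem eq_solid (h : IsGeneratedBy K a f) : (K : Set E3) = solid a f := by
  rw [h.eq_revolve, revolve_generatingDomain h.even h.nonneg]

theorem antitoneOn (h : IsGeneratedBy K a f) : AntitoneOn f (Icc 0 a) := by
  intro x hx y hy hxy
  have hy' : y ∈ Icc (-a) a := ⟨by linarith [hy.1, h.pos], hy.2⟩
  have hny' : -y ∈ Icc (-a) a := ⟨by linarith [hy.2], by linarith [hy.1, h.pos]⟩
  have := h.concave.min_le_of_mem_Icc hny' hy' ⟨by linarith [hx.1, hy.1], hxy⟩
  rwa [h.even y hy', min_self] at this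

/-- The point is `0 < f 0`: otherwise `f` vanishes on `[0, a]` and the body has volume zero, against
its nonempty interior. -/
theorem isRadius (h : IsGeneratedBy K a f) : IsRadius a f := by
  have hsub : Icc 0 a ⊆ Icc (-a) a := Icc_subset_Icc_left (by linarith [h.pos])
  have h0 : (0 : ℝ) ∈ Icc 0 a := left_mem_Icc.2 h.pos.le
  have hnn : ∀ x ∈ Icc 0 a, 0 ≤ f x := fun x hx => h.nonneg x (hsub hx)
  refine ⟨h.pos, h.concave.subset hsub (convex_Icc _ _), h.antitoneOn, hnn, ?_⟩
  by_contra hle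
  have hz : ∀ x ∈ Icc 0 a, f x = 0 := fun x hx =>
    le_antisymm ((h.antitoneOn h0 hx hx.1).trans (not_lt.1 hle)) (hnn x hx)
  have hvol := volume_real_solid h.pos h.antitoneOn hnn
  have hint : ∫ u in (0)..a, f u ^ 2 = 0 := by
    rw [intervalIntegral.integral_congr (g := fun _ => 0)]
    · simp
    · intro x hx
      rw [uIcc_of_le h.pos.le] at hx
      simp [hz x hx]
  rw [hint, mul_zero, ← h.eq_solid, measureReal_def, ENNReal.toReal_eq_zero_iff] at hvol
  rcases hvol with hvol | hvol
  · exact (Measure.measure_pos_of_nonempty_interior volume h.interior_nonempty).ne' hvol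
  · exact K.isCompact.measure_lt_top.ne hvol

theorem mahlerVolume_eq (h : IsGeneratedBy K a f) :
    mahlerVolume (K : Set E3) = 4 * Real.pi ^ 2 / 3 *
      (polarMoment (halfWidth a f) * (3 * radialMoment (halfWidth a f))) := by
  rw [h.eq_solid, h.isRadius.mahlerVolume_solid]

theorem le_mahlerVolume (h : IsGeneratedBy K a f) :
    4 * Real.pi ^ 2 / 3 ≤ mahlerVolume (K : Set E3) := by
  rw [h.mahlerVolume_eq]
  exact le_mul_of_one_le_right (by positivity) (h.isRadius.isProfile_halfWidth.one_le_mul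
    h.isRadius.concaveOn_halfWidth h.isRadius.continuousOn_halfWidth)

theorem mahlerVolume_eq_iff (h : IsGeneratedBy K a f) :
    mahlerVolume (K : Set E3) = 4 * Real.pi ^ 2 / 3 ↔
      (∀ y ∈ Icc (0 : ℝ) 1, halfWidth a f y = a) ∨
        ∀ y ∈ Icc (0 : ℝ) 1, halfWidth a f y = a * (1 - y) := by
  have hr := h.isRadius
  have hP := hr.isProfile_halfWidth
  have hH0 := hr.halfWidth_zero
  have ha := h.pos
  have h1m : (1 : ℝ) ∈ Icc (0 : ℝ) 1 := right_mem_Icc.2 zero_le_one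
  rw [h.mahlerVolume_eq, mul_eq_left₀ (by positivity)]
  constructor
  · intro heq
    have haff := hP.eq_affine_of_mul_eq_one hr.concaveOn_halfWidth hr.continuousOn_halfWidth heq
    rw [hP.mul_of_affine haff, hH0] at heq
    rw [hH0] at haff
    have hm := hr.halfWidth_mem h1m
    have ht1 : halfWidth a f 1 / a ≤ 1 := (div_le_one ha).2 hm.2
    have hprod : halfWidth a f 1 / a * (1 - halfWidth a f 1 / a) = 0 := by
      -- The ratio is at most 1, so the third factor of the cubic is at least 1 and only the ratios
      -- 0 and 1 remain.
      have h3 : (3 - 2 * (halfWidth a f 1 / a)) ≠ 0 := by linarith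
      have : halfWidth a f 1 / a * (1 - halfWidth a f 1 / a) *
          (3 - 2 * (halfWidth a f 1 / a)) = 0 := by linarith
      exact (mul_eq_zero.1 this).resolve_right h3
    rcases mul_eq_zero.1 hprod with h0 | h0
    · right
      have : halfWidth a f 1 = 0 := (div_eq_zero_iff.1 h0).resolve_right ha.ne'
      intro y hy
      rw [haff y hy, this]
      ring
    · left
      have : halfWidth a f 1 = a := by
        rw [← div_eq_one_iff_eq ha.ne']
        linarith
      intro y hy
      rw [haff y hy, this]
      ring
  · rintro (hc | hc)
    · rw [hP.mul_of_affine, hc 1 h1m, hH0, div_self ha.ne']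
      · ring
      · intro y hy
        rw [hc y hy, hc 1 h1m, hH0]
        ring
    · have h1 := hc 1 h1m
      rw [sub_self, mul_zero] at h1
      rw [hP.mul_of_affine, h1]
      · ring
      · intro y hy
        rw [hc y hy, h1, hH0]
        ring

/-- The half-width at level 1 determines `f` only on `[0, a)`. A drop of `f` at the endpoint `a` is
excluded because `K` is closed. -/
theorem isCylinder (h : IsGeneratedBy K a f)
    (hH : ∀ y ∈ Icc (0 : ℝ) 1, halfWidth a f y = a) : IsCylinder K := by
  have hr := h.isRadius
  have ha := h.pos
  have hlt : ∀ x ∈ Ico 0 a, f x = f 0 := by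
    intro x hx
    have h1m : (1 : ℝ) ∈ Icc (0 : ℝ) 1 := right_mem_Icc.2 zero_le_one
    have := hr.le_of_lt_halfWidth h1m hx.1 (by rw [hH 1 h1m]; exact hx.2)
    exact le_antisymm (hr.le_center (Ico_subset_Icc_self hx)) (by simpa using this)
  have hclosed : IsClosed (solid a f) := by rw [← h.eq_solid]; exact K.isCompact.isClosed
  have hcont : Continuous fun x : ℝ => (!₂[x, f 0, 0] : E3) := by fun_prop
  have hpre := hclosed.preimage hcont
  have hmem : ∀ x ∈ Icc 0 a, f x = f 0 → x ∈ (fun x : ℝ => (!₂[x, f 0, 0] : E3)) ⁻¹' solid a f := by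
    intro x hx hfx
    simp only [mem_preimage, solid, mem_ofPred_eq]
    simp [abs_of_nonneg hx.1, hx.2, hfx]
  have hend : a ∈ (fun x : ℝ => (!₂[x, f 0, 0] : E3)) ⁻¹' solid a f := by
    have hcl : a ∈ closure (Ico 0 a) := by
      rw [closure_Ico ha.ne]
      exact hr.end_mem
    exact closure_minimal (fun x hx => hmem x (Ico_subset_Icc_self hx) (hlt x hx)) hpre hcl
  have hfa : f a = f 0 := by
    have := hend.2
    simp [abs_of_pos ha] at this
    refine le_antisymm (hr.le_center hr.end_mem) ?_
    exact abs_le_of_sq_le_sq' this (hr.nonneg a hr.end_mem) |>.2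
  refine ⟨a, f, h, f 0, fun x hx => ?_⟩
  have hpos : ∀ x ∈ Icc 0 a, f x = f 0 := by
    intro x hx
    rcases hx.2.eq_or_lt with rfl | hxa
    · exact hfa
    · exact hlt x ⟨hx.1, hxa⟩
  rcases le_total 0 x with h0 | h0
  · exact hpos x ⟨h0, hx.2⟩
  · rw [← h.even x hx]
    exact hpos (-x) ⟨by linarith, by linarith [hx.1]⟩

/-- Evaluating the half-width at level `f x / f 0` bounds `f x` above by the linear function;
concavity with `f a ≥ 0` bounds it below. -/
theorem isBicone (h : IsGeneratedBy K a f)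
    (hH : ∀ y ∈ Icc (0 : ℝ) 1, halfWidth a f y = a * (1 - y)) : IsBicone K := by
  have hr := h.isRadius
  have ha := h.pos
  have hf0 := hr.center
  have hpos : ∀ x ∈ Icc 0 a, f x = f 0 * (1 - x / a) := by
    intro x hx
    have hxa : x / a ≤ 1 := (div_le_one ha).2 hx.2
    have hxa0 : 0 ≤ x / a := div_nonneg hx.1 ha.le
    apply le_antisymm
    · have hy : f x / f 0 ∈ Icc (0 : ℝ) 1 :=
        ⟨div_nonneg (hr.nonneg _ hx) hf0.le, (div_le_one hf0).2 (hr.le_center hx)⟩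
      have hle := IsRadius.le_halfWidth (f := f) (y := f x / f 0) hx
        (by rw [mul_div_cancel₀ _ hf0.ne'])
      rw [hH _ hy] at hle
      have h1 : x / a ≤ 1 - f x / f 0 := by
        rw [div_le_iff₀ ha]
        linarith
      have h2 : f x / f 0 ≤ 1 - x / a := by linarith
      rw [div_le_iff₀ hf0] at h2
      linarith
    · have := hr.concave.2 hr.zero_mem hr.end_mem (sub_nonneg.2 hxa) hxa0 (by ring)
      have e : (1 - x / a) • (0 : ℝ) + (x / a) • a = x := by
        simp only [smul_eq_mul]; field_simp; ring
      rw [e] at this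
      simp only [smul_eq_mul] at this
      have := mul_nonneg hxa0 (hr.nonneg a hr.end_mem)
      linarith
  have hneg : ∀ x ∈ Icc (-a) 0, f x = f 0 / a * x + f 0 := by
    intro x hx
    rw [← h.even x ⟨hx.1, hx.2.trans ha.le⟩, hpos (-x) ⟨by linarith [hx.2], by linarith [hx.1]⟩]
    ring
  refine ⟨a, f, h, ⟨f 0 / a, f 0, hneg⟩, ?_⟩
  rw [hneg (-a) ⟨le_rfl, by linarith⟩]
  field_simp
  ring

theorem halfWidth_of_const (h : IsGeneratedBy K a f) {r : ℝ} (hf : ∀ x ∈ Icc (-a) a, f x = r) :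
    ∀ y ∈ Icc (0 : ℝ) 1, halfWidth a f y = a := by
  intro y hy
  have hr := h.isRadius
  have ha := h.pos
  refine le_antisymm (hr.halfWidth_mem hy).2 (IsRadius.le_halfWidth hr.end_mem ?_)
  rw [hf a ⟨by linarith, le_rfl⟩, ← hf 0 ⟨by linarith, ha.le⟩]
  exact mul_le_of_le_one_right hr.center.le hy.2

theorem halfWidth_of_linear (h : IsGeneratedBy K a f) {m c : ℝ}
    (hf : ∀ x ∈ Icc (-a) 0, f x = m * x + c) (hfa : f (-a) = 0) :
    ∀ y ∈ Icc (0 : ℝ) 1, halfWidth a f y = a * (1 - y) := by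
  intro y hy
  have hr := h.isRadius
  have ha := h.pos
  have hf0 := hr.center
  have hc : f 0 = c := by simpa using hf 0 ⟨by linarith, le_rfl⟩
  have hm : c = m * a := by
    have := hf (-a) ⟨le_rfl, by linarith⟩
    linarith
  have hpos : ∀ x ∈ Icc 0 a, f x = m * (a - x) := by
    intro x hx
    rw [← h.even x ⟨by linarith [hx.1], hx.2⟩, hf (-x) ⟨by linarith [hx.2], by linarith [hx.1]⟩, hm]
    ring
  have hmpos : 0 < m := by
    rw [hc, hm] at hf0
    exact pos_of_mul_pos_left hf0 ha.le
  have hlevel : ∀ x ∈ Icc 0 a, (f 0 * y ≤ f x ↔ x ≤ a * (1 - y)) := by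
    intro x hx
    rw [hpos x hx, hc, hm, mul_assoc, mul_le_mul_iff_right₀ hmpos]
    constructor <;> intro h <;> linarith
  have hmem : a * (1 - y) ∈ Icc 0 a :=
    ⟨mul_nonneg ha.le (by linarith [hy.2]), mul_le_of_le_one_right ha.le (by linarith [hy.1])⟩
  apply le_antisymm
  · exact csSup_le (hr.level_nonempty hy) fun x hx => (hlevel x hx.1).1 hx.2
  · exact IsRadius.le_halfWidth hmem ((hlevel _ hmem).2 le_rfl)

end IsGeneratedBy

end

end MahlerRevolution

theorem theorem1p1 (K : ConvexBody MahlerRevolution.E3)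
    (hK : MahlerRevolution.IsOriginSymmetricBodyOfRevolution K) :
    4 * Real.pi ^ 2 / 3 ≤ MahlerRevolution.mahlerVolume (K : Set MahlerRevolution.E3) ∧
      (MahlerRevolution.mahlerVolume (K : Set MahlerRevolution.E3) = 4 * Real.pi ^ 2 / 3 ↔
        MahlerRevolution.IsCylinder K ∨ MahlerRevolution.IsBicone K) := by
  obtain ⟨a, f, h⟩ := hK
  refine ⟨h.le_mahlerVolume, fun heq => ?_, ?_⟩
  · rcases h.mahlerVolume_eq_iff.1 heq with hH | hH
    · exact Or.inl (h.isCylinder hH)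
    · exact Or.inr (h.isBicone hH)
  -- The generating data of the cylinder or bicone need not be `a`, `f`; since the Mahler volume
  -- depends on `K` alone, the criterion is applied to `b`, `g`.
  · rintro (⟨b, g, hg, r, hr⟩ | ⟨b, g, hg, ⟨m, c, hmc⟩, hgb⟩)
    · exact hg.mahlerVolume_eq_iff.2 (Or.inl (hg.halfWidth_of_const hr))
    · exact hg.mahlerVolume_eq_iff.2 (Or.inr (hg.halfWidth_of_linear hmc hgb))
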